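/- Let $D, D_0, D_1, \dots$ be i.i.d. non-negative demands with mean $\mu_D$ and variance $\sigma_D^2\in(0,\infty)$, let $h,p\ge 0$ be the holding and lost-sales costs, and fix a constant order $0\le r<\mu_D$. Put $Y=D-r$, with distribution $F_Y$. For an initial inventory $J_0=x\ge 0$ let $J_{t+1}=(J_t+r-D_t)^+$, and let the cost of period $t$ be $c_t^x=h(J_t+r-D_t)^++p(D_t-J_t-r)^+$. Let $S_t$ be the random walk with $S_0=0$ and i.i.d. increments distributed as $Y$, let $\tau_+=\inf\{t>0:S_t\ge 0\}$, let $G_+$ be the distribution of the ladder height $S_{\tau_+}$, $\mu_+=\mathbb E[S_{\tau_+}]$, and let $U_+=\sum_{n\ge 0}G_+^{*n}$ be the ascending ladder-height renewal measure, with $U_+(y)=U_+((-\infty,y])$. Then $\tau_+<\infty$ almost surely, $\mu_+$ and all $U_+(y)$ are finite, and the steady-state inventory $J_\infty$, with $\mathbb P\{J_\infty\le y\}=\lim_{t\to\infty}\mathbb P\{J_t\le y\}$ for all $y$ when $J_0=0$, exists and has a finite mean. With $$a_r(x)=h\,\mathbb E[(x-Y)^+]+p\,\mathbb E[(Y-x)^+]-p\,\mathbb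 E[Y]-h\,\mathbb E[J_\infty],$$ the function $$v_r(x)=\frac{h\,\mu_+}{\mu_D-r}\int_0^xU_+(y)\,dy-(h+p)\,x,\qquad x\ge 0,$$ is the relative value function of the constant-order policy $C_r$: 1. it solves the Wiener–Hopf equation $$v(x)=a_r(x)+\int_{(-\infty,x]}v(x-y)\,F_Y(dy)\quad(x\ge 0),\qquad v(0)=0,$$ the integral being absolutely convergent; 2. it is the only solution $v$ such that $|v(x)|\le Ce^{\varepsilon x}$ for all $x\ge 0$, for some $C$ and some $\varepsilon>0$ with $\mathbb E[e^{-\varepsilon Y}]<1$; 3. for all $x_1,x_2\ge 0$, the difference $v_r(x_1)-v_r(x_2)$ is the additional total long-run expected cost of starting from $x_1$ rather than from $x_2$: $$v_r(x_1)-v_r(x_2)=\lim_{T\to\infty}\Big(\mathbb E\Big[\sum_{t=0}^{T-1}c_t^{x_1}\Big]-\mathbb E\Big[\sum_{t=0}^{T-1}c_t^{x_2}\Big]\Big).$$ -/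

import Mathlib

open MeasureTheory ProbabilityTheory Filter Topology Set

namespace LostSales

noncomputable section

variable {Ω : Type*} [MeasurableSpace Ω]

/-- Law `F_Y` of the excess demand `Y = D - r`. -/
def excessLaw (P : Measure Ω) (D : ℕ → Ω → ℝ) (r : ℝ) : Measure ℝ :=
  P.map (fun ω => D 0 ω - r)

/-- Inventory level `J_t` at the beginning of period `t` when every order equals `r` and the
initial level is `x`: `J_0 = x`, `J_{t+1} = (J_t + r - D_t)^+`. -/
def inventory (D : ℕ → Ω → ℝ) (r x : ℝ) : ℕ → Ω → ℝ
  | 0, _ => x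
  | t + 1, ω => max (inventory D r x t ω + r - D t ω) 0

/-- Cost incurred in period `t` under the constant order `r`, from initial level `x`. -/
def periodCost (D : ℕ → Ω → ℝ) (h p r x : ℝ) (t : ℕ) (ω : Ω) : ℝ :=
  h * max (inventory D r x t ω + r - D t ω) 0 + p * max (D t ω - inventory D r x t ω - r) 0

/-- `ν` is the law of the steady-state inventory level `J_∞`:
`P(J_∞ ≤ y) = lim_t P(J_t ≤ y)` for every `y`, the process being started at `J_0 = 0`. -/
structure IsSteadyState (P : Measure Ω) (D : ℕ → Ω → ℝ) (r : ℝ) (ν : Measure ℝ) : Prop where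
  isProbabilityMeasure : IsProbabilityMeasure ν
  tendsto : ∀ y : ℝ,
    Tendsto (fun t : ℕ => P.real {ω | inventory D r 0 t ω ≤ y}) atTop (𝓝 (ν.real (Iic y)))

/-- The inhomogeneous term
`a_r(x) = h E[(x - Y)^+] + p E[(Y - x)^+] - p E[Y] - h E[J_∞]`,
where `F` is the law of `Y` and `ν` is the law of `J_∞`. -/
def inhomogeneity (h p : ℝ) (F ν : Measure ℝ) (x : ℝ) : ℝ :=
  h * ∫ y, max (x - y) 0 ∂F + p * ∫ y, max (y - x) 0 ∂F - p * ∫ y, y ∂F - h * ∫ z, z ∂ν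

/-- `v` solves the Wiener–Hopf equation `v = a + v * F` on `[0, ∞)`, with `v 0 = 0`, where
`(v * F)(x) = ∫_{(-∞, x]} v (x - y) F(dy)` is required to be a convergent integral.
Only the values of `v` on `[0, ∞)` matter. -/
structure IsWienerHopfSolution (a : ℝ → ℝ) (F : Measure ℝ) (v : ℝ → ℝ) : Prop where
  zero : v 0 = 0
  integrable : ∀ x, 0 ≤ x → IntegrableOn (fun y => v (x - y)) (Iic x) F
  eqn : ∀ x, 0 ≤ x → v x = a x + ∫ y in Iic x, v (x - y) ∂F

/-- `v` grows at most like `e^{εx}` for some `ε > 0` with `E[e^{-εY}] < 1`. If `Y` is bounded below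
and has positive mean, then every small `ε > 0` qualifies, so that all functions of polynomial
growth are included. -/
def HasModerateGrowth (F : Measure ℝ) (v : ℝ → ℝ) : Prop :=
  ∃ ε C : ℝ, 0 < ε ∧ ∫ y, Real.exp (-ε * y) ∂F < 1 ∧ ∀ x, 0 ≤ x → |v x| ≤ C * Real.exp (ε * x)

/-- The random walk `S_t`, the sum of the first `t` of the i.i.d. increments `D_i - r`. -/
def walk (D : ℕ → Ω → ℝ) (r : ℝ) (t : ℕ) (ω : Ω) : ℝ :=
  ∑ i ∈ Finset.range t, (D i ω - r)

/-- The event `τ_+ < ∞`. -/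
def ladderEvent (D : ℕ → Ω → ℝ) (r : ℝ) : Set Ω :=
  {ω | ∃ t : ℕ, 0 < t ∧ 0 ≤ walk D r t ω}

/-- The weak ascending ladder period `τ_+ = inf {t > 0 : S_t ≥ 0}`; it is only used on
`ladderEvent`. -/
def ladderTime (D : ℕ → Ω → ℝ) (r : ℝ) (ω : Ω) : ℕ :=
  sInf {t : ℕ | 0 < t ∧ 0 ≤ walk D r t ω}

/-- The distribution `G_+` of the ladder height `S_{τ_+}` (on the event `τ_+ < ∞`). -/
def ladderLaw (P : Measure Ω) (D : ℕ → Ω → ℝ) (r : ℝ) : Measure ℝ :=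
  (P.restrict (ladderEvent D r)).map (fun ω => walk D r (ladderTime D r ω) ω)

/-- The mean ladder height `μ_+`. -/
def ladderMean (P : Measure Ω) (D : ℕ → Ω → ℝ) (r : ℝ) : ℝ :=
  ∫ z, z ∂(ladderLaw P D r)

/-- The `n`-fold convolution power of a measure; the zeroth power is `δ_0`. -/
def convPow (G : Measure ℝ) : ℕ → Measure ℝ
  | 0 => Measure.dirac 0
  | n + 1 => (convPow G n).conv G

/-- The renewal measure `U_+ = ∑_n G_+^{*n}`. -/
def renewalMeasure (P : Measure Ω) (D : ℕ → Ω → ℝ) (r : ℝ) : Measure ℝ :=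
  Measure.sum (fun n => convPow (ladderLaw P D r) n)

/-- The function `(h μ_+ / (μ_D - r)) ∫_0^x U_+(y) dy - (h + p) x`, with
`U_+(y) = U_+((-∞, y])`. -/
def explicitValue (P : Measure Ω) (D : ℕ → Ω → ℝ) (h p r x : ℝ) : ℝ :=
  h * ladderMean P D r / ((∫ ω, D 0 ω ∂P) - r)
      * (∫ y in (0 : ℝ)..x, (renewalMeasure P D r).real (Iic y))
    - (h + p) * x

end

end LostSales

namespace LostSales

open scoped ENNReal

variable {Ω : Type*} [MeasurableSpace Ω]

/-! Everything is a statement about the excess stock caused by the initial level. Unrolling the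
recursion gives `J_t = max (x, M_t) - S_t` with `M_t = max_{s ≤ t} S_s`, so starting from `x` rather
than `0` adds exactly `(x - M_t)^+` to the stock (`inventory_eq_add`). Lost sales telescope against
stock changes, so long-run cost differences are those of `h g(x) - (h + p) x`, where `g(x) = ∑_t
E[(x - M_t)^+]` is `meanGain`.

To identify `g`, write `(x - M_t)^+` as the length of `{y ∈ [0, x] : M_t ≤ y}`. By Tonelli, `g` is
the integral of `m(y) = ∑_t P(M_t ≤ y)` (`meanPassage`). Restarting the walk at its first ladder
epoch gives a renewal equation for `m`, whence `m = E[τ_+] U_+`; and `μ_+ = E[τ_+] E[Y]` by Wald's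
identity. Everything is finite because `P(S_t ≤ y) ≤ e^{εy} φ^t` with `φ = E[e^{-εY}] < 1`.

For the Wiener–Hopf equation, condition on the first demand: with `F_t = E[J_t]` from an empty
start, `F_{t+1} + E[(x - M_{t+1})^+] = F_t + E[(x - Y - M_t)^+]`, the last `Y` being independent of
`M_t`. Summing over `t` telescopes `F` and leaves `E[J_∞] + g(x) = x + E[g(x - Y)]`
(`meanGain_step`). The limit of `F_t` exists because reversing the demands makes the stock increase
pathwise. Uniqueness holds because convolution with `F_Y` contracts the norm `sup e^{-εx} |v(x)|` by
the factor `φ`. -/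

/-! ### I.i.d. demand sequences and the Markov property -/

/-- The demands `D 0, D 1, …` are measurable, independent and identically distributed. -/
structure IsIID (P : Measure Ω) (D : ℕ → Ω → ℝ) : Prop where
  meas : ∀ t, Measurable (D t)
  indep : iIndepFun D P
  ident : ∀ t, IdentDistrib (D t) (D 0) P P

theorem IsIID.map_shift {P : Measure Ω} {D : ℕ → Ω → ℝ} (hD : IsIID P D) (k : ℕ) :
    P.map (fun ω i => D (k + i) ω) = P.map (fun ω i => D i ω) := by
  rw [(hD.indep.precomp (g := fun i => k + i)
    (add_right_injective k)).map_fun_eq_infinitePi_map (fun i => hD.meas (k + i)),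
    hD.indep.map_fun_eq_infinitePi_map hD.meas]
  congr 1
  funext i
  exact (hD.ident (k + i)).map_eq.trans (hD.ident i).map_eq.symm

/-- The two families use disjoint sets of indices. The past is padded with zeros so that it remains
a point of the sequence space. -/
theorem IsIID.indepFun_shift {P : Measure Ω} {D : ℕ → Ω → ℝ} (hD : IsIID P D) (k : ℕ) :
    IndepFun (fun ω (i : ℕ) => if i < k then D i ω else 0) (fun ω i => D (k + i) ω) P := by
  have hind : iIndep (fun i => MeasurableSpace.comap (D i) inferInstance) P := hD.indep.iIndep
  have h := indep_iSup_of_disjoint (fun i => (hD.meas i).comap_le) hind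
    (S := {i | i < k}) (T := {i | k ≤ i})
    (Set.disjoint_left.2 fun i (h1 : i < k) (h2 : k ≤ i) => absurd h1 (not_lt.2 h2))
  rw [IndepFun_iff_Indep]
  refine indep_of_indep_of_le_left (indep_of_indep_of_le_right h ?_) ?_
  · rw [← measurable_iff_comap_le]
    refine (@measurable_pi_iff _ _ _ (_) _ _).2 fun i => ?_
    rw [measurable_iff_comap_le]
    exact le_iSup₂_of_le (k + i) (Nat.le_add_right k i) le_rfl
  · rw [← measurable_iff_comap_le]
    refine (@measurable_pi_iff _ _ _ (_) _ _).2 fun i => ?_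
    by_cases hi : i < k
    · simp only [hi, if_true]
      rw [measurable_iff_comap_le]
      exact le_iSup₂_of_le i hi le_rfl
    · simp only [hi, if_false]
      exact measurable_const

/-- The Markov property: given the first `k` demands, the later demands are distributed as a fresh
copy of the whole sequence. -/
theorem IsIID.lintegral_split {P : Measure Ω} [IsProbabilityMeasure P] {D : ℕ → Ω → ℝ}
    (hD : IsIID P D) (k : ℕ) {f : (ℕ → ℝ) → (ℕ → ℝ) → ℝ≥0∞} (hf : Measurable (Function.uncurry f))
    (hdep : ∀ a a' b, (∀ i < k, a i = a' i) → f a b = f a' b) :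
    ∫⁻ ω, f (fun i => D i ω) (fun i => D (k + i) ω) ∂P =
      ∫⁻ ω, ∫⁻ ω', f (fun i => D i ω) (fun i => D i ω') ∂P ∂P := by
  -- By `hdep` the full path in the first argument may be replaced by the padded past `X`, which is
  -- independent of the future `Z`.
  set X : Ω → ℕ → ℝ := fun ω i => if i < k then D i ω else 0
  set Z : Ω → ℕ → ℝ := fun ω i => D (k + i) ω
  have hX : Measurable X := by
    refine measurable_pi_iff.2 fun i => ?_
    by_cases hi : i < k
    · simpa [X, hi] using hD.meas i
    · simp [X, hi]
  have hZ : Measurable Z := measurable_pi_iff.2 fun i => hD.meas _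
  have hI : Measurable (fun ω i => D i ω) := measurable_pi_iff.2 fun i => hD.meas i
  have hXa : ∀ ω b, f (fun i => D i ω) b = f (X ω) b := fun ω b =>
    hdep _ _ _ fun i hi => by simp [X, hi]
  have hmap := (indepFun_iff_map_prod_eq_prod_map_map hX.aemeasurable hZ.aemeasurable).1
    (hD.indepFun_shift k)
  have := Measure.isProbabilityMeasure_map (μ := P) hZ.aemeasurable
  have := Measure.isProbabilityMeasure_map (μ := P) hX.aemeasurable
  simp only [hXa]
  calc ∫⁻ ω, f (X ω) (Z ω) ∂P = ∫⁻ q, Function.uncurry f q ∂(P.map fun ω => (X ω, Z ω)) := by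
        rw [lintegral_map hf (hX.prodMk hZ)]; rfl
    _ = ∫⁻ a, ∫⁻ b, f a b ∂(P.map Z) ∂(P.map X) := by
        rw [hmap, lintegral_prod _ hf.aemeasurable]; rfl
    _ = ∫⁻ ω, ∫⁻ b, f (X ω) b ∂(P.map Z) ∂P :=
        lintegral_map hf.lintegral_prod_right' hX
    _ = _ := by
        refine lintegral_congr fun ω => ?_
        rw [hD.map_shift k, lintegral_map (hf.of_uncurry_left) hI]

/-! ### Pathwise identities for the walk, its running maximum and the inventory -/

/-- The coordinate process on the space of demand sequences. -/
def coord (t : ℕ) (d : ℕ → ℝ) : ℝ := d t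

theorem measurable_walk (D : ℕ → Ω → ℝ) (hD : ∀ t, Measurable (D t)) (r : ℝ) (t : ℕ) :
    Measurable (walk D r t) :=
  Finset.measurable_fun_sum _ fun i _ => (hD i).sub_const r

theorem measurable_inventory (D : ℕ → Ω → ℝ) (hD : ∀ t, Measurable (D t)) (r x : ℝ) (t : ℕ) :
    Measurable (inventory D r x t) := by
  induction t with
  | zero => exact measurable_const
  | succ t ih => exact ((ih.add_const r).sub (hD t)).max measurable_const

theorem measurable_coord (t : ℕ) : Measurable (coord t) := measurable_pi_apply t

theorem walk_zero {Ω : Type*} (D : ℕ → Ω → ℝ) (r : ℝ) (ω : Ω) : walk D r 0 ω = 0 := by simp [walk]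

theorem walk_succ {Ω : Type*} (D : ℕ → Ω → ℝ) (r : ℝ) (t : ℕ) (ω : Ω) :
    walk D r (t + 1) ω = walk D r t ω + (D t ω - r) := by
  rw [walk, walk, Finset.sum_range_succ]

theorem walk_add (r : ℝ) (k j : ℕ) (d : ℕ → ℝ) :
    walk coord r (k + j) d = walk coord r k d + walk coord r j (fun i => d (k + i)) := by
  simp only [walk, Finset.sum_range_add, coord]

/-- Moves the walk to the sequence space, where it can be evaluated at shifted or resampled demands.
-/
theorem walk_eq {Ω : Type*} (D : ℕ → Ω → ℝ) (r : ℝ) (t : ℕ) (ω : Ω) :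
    walk D r t ω = walk coord r t (fun i => D i ω) := rfl

theorem walk_congr {r : ℝ} {t : ℕ} {a b : ℕ → ℝ} (h : ∀ i < t, a i = b i) :
    walk coord r t a = walk coord r t b :=
  Finset.sum_congr rfl fun i hi => by simp [coord, h i (Finset.mem_range.1 hi)]

theorem inventory_eq {Ω : Type*} (D : ℕ → Ω → ℝ) (r x : ℝ) (t : ℕ) (ω : Ω) :
    inventory D r x t ω = inventory coord r x t (fun i => D i ω) := by
  induction t with
  | zero => rfl
  | succ t ih => simp [inventory, ih, coord]

theorem inventory_congr {r x : ℝ} {t : ℕ} {a b : ℕ → ℝ} (h : ∀ i < t, a i = b i) :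
    inventory coord r x t a = inventory coord r x t b := by
  induction t with
  | zero => rfl
  | succ t ih => simp [inventory, ih fun i hi => h i (by omega), coord, h t (by omega)]

/-- Peels off the first demand instead of the last, as conditioning on the first period requires. -/
theorem inventory_succ_front (r x : ℝ) (t : ℕ) (d : ℕ → ℝ) :
    inventory coord r x (t + 1) d =
      inventory coord r (max (x + r - d 0) 0) t (fun i => d (1 + i)) := by
  induction t with
  | zero => simp [inventory, coord]
  | succ t ih =>
    rw [inventory, ih]
    conv_rhs => rw [inventory]
    simp [coord, add_comm 1 t]

/-- The running maximum `max_{s ≤ t} S_s` of the random walk. -/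
noncomputable def runMax (D : ℕ → Ω → ℝ) (r : ℝ) : ℕ → Ω → ℝ
  | 0, _ => 0
  | t + 1, ω => max (runMax D r t ω) (walk D r (t + 1) ω)

theorem measurable_runMax (D : ℕ → Ω → ℝ) (hD : ∀ t, Measurable (D t)) (r : ℝ) (t : ℕ) :
    Measurable (runMax D r t) := by
  induction t with
  | zero => exact measurable_const
  | succ t ih => exact ih.max (measurable_walk D hD r (t + 1))

theorem runMax_eq {Ω : Type*} (D : ℕ → Ω → ℝ) (r : ℝ) (t : ℕ) (ω : Ω) :
    runMax D r t ω = runMax coord r t (fun i => D i ω) := by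
  induction t with
  | zero => rfl
  | succ t ih => simp [runMax, ih, walk_eq D]

theorem runMax_le_iff {Ω : Type*} (D : ℕ → Ω → ℝ) (r : ℝ) (t : ℕ) (ω : Ω) (y : ℝ) :
    runMax D r t ω ≤ y ↔ ∀ s ≤ t, walk D r s ω ≤ y := by
  induction t with
  | zero => simp [runMax, walk_zero]
  | succ t ih =>
    rw [runMax, max_le_iff, ih]
    constructor
    · rintro ⟨h1, h2⟩ s hs
      rcases Nat.lt_or_ge t s with h | h
      · rwa [show s = t + 1 by omega]
      · exact h1 s h
    · exact fun h => ⟨fun s hs => h s (by omega), h _ le_rfl⟩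

theorem walk_le_runMax {Ω : Type*} (D : ℕ → Ω → ℝ) (r : ℝ) (t : ℕ) (ω : Ω) :
    walk D r t ω ≤ runMax D r t ω :=
  (runMax_le_iff D r t ω _).1 le_rfl t le_rfl

theorem runMax_nonneg {Ω : Type*} (D : ℕ → Ω → ℝ) (r : ℝ) (t : ℕ) (ω : Ω) : 0 ≤ runMax D r t ω := by
  simpa [walk_zero] using (runMax_le_iff D r t ω _).1 le_rfl 0 (Nat.zero_le t)

/-- Starting from `x` instead of `0` raises the inventory level by `(x - max_{s ≤ t} S_s)^+`. -/
theorem inventory_eq_add {Ω : Type*} {x : ℝ} (hx : 0 ≤ x) (D : ℕ → Ω → ℝ) (r : ℝ) (t : ℕ) (ω : Ω) :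
    inventory D r x t ω = inventory D r 0 t ω + max (x - runMax D r t ω) 0 := by
  -- Reflection formula: the initial level enters only through the maximum, so the two starts share
  -- the term `-S_t`.
  have key : ∀ z : ℝ, 0 ≤ z →
      inventory D r z t ω = max z (runMax D r t ω) - walk D r t ω := by
    intro z hz
    induction t with
    | zero => simp [inventory, runMax, walk_zero, hz]
    | succ t ih =>
      rw [inventory, ih, runMax, walk_succ, ← max_assoc, ← sub_eq_zero]
      rcases le_total (max z (runMax D r t ω)) (walk D r t ω + (D t ω - r)) with h | h
      · rw [max_eq_right h, max_eq_right (by linarith)]; ring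
      · rw [max_eq_left h, max_eq_left (by linarith)]; ring
  rw [key x hx, key 0 le_rfl, max_eq_right (runMax_nonneg D r t ω)]
  rcases le_total x (runMax D r t ω) with h | h
  · rw [max_eq_right h, max_eq_right (by linarith)]; ring
  · rw [max_eq_left h, max_eq_left (by linarith)]; ring

theorem inventory_nonneg {Ω : Type*} {x : ℝ} (hx : 0 ≤ x) (D : ℕ → Ω → ℝ) (r : ℝ) (t : ℕ) (ω : Ω) :
    0 ≤ inventory D r x t ω := by
  cases t with
  | zero => exact hx
  | succ t => exact le_max_right _ _

/-! ### Time reversal -/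

/-- The inventory level after `t` periods, with the demands taken in the reverse order. -/
noncomputable def backInventory (r : ℝ) : ℕ → (ℕ → ℝ) → ℝ
  | 0, _ => 0
  | t + 1, d => max (backInventory r t (fun i => d (1 + i)) + r - d 0) 0

theorem measurable_backInventory (r : ℝ) (t : ℕ) : Measurable (backInventory r t) := by
  induction t with
  | zero => exact measurable_const
  | succ t ih =>
    exact (((ih.comp (measurable_pi_iff.2 fun i => measurable_pi_apply (1 + i))).add_const
      r).sub (measurable_pi_apply 0)).max measurable_const

/-- A further period is added at the remote past, where it can only raise the stock above its
initial value `0`; the later steps are monotone and preserve this. -/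
theorem backInventory_mono (r : ℝ) (d : ℕ → ℝ) : Monotone (fun t => backInventory r t d) := by
  refine monotone_nat_of_le_succ fun t => ?_
  induction t generalizing d with
  | zero => exact le_max_right _ _
  | succ t ih =>
    refine max_le_max ?_ le_rfl
    have := ih (fun i => d (1 + i))
    linarith

theorem backInventory_nonneg (r : ℝ) (t : ℕ) (d : ℕ → ℝ) : 0 ≤ backInventory r t d :=
  backInventory_mono r d (Nat.zero_le t)

/-- Reversing finitely many i.i.d. demands does not change their law. In the induction, the last
forward demand plays the role of the first backward one. -/
theorem lintegral_backInventory {P : Measure Ω} [IsProbabilityMeasure P] {D : ℕ → Ω → ℝ}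
    (hD : IsIID P D) (r : ℝ) (t : ℕ) {g : ℝ → ℝ≥0∞} (hg : Measurable g) :
    ∫⁻ ω, g (inventory D r 0 t ω) ∂P = ∫⁻ ω, g (backInventory r t (fun i => D i ω)) ∂P := by
  have hI : Measurable (fun ω i => D i ω) := measurable_pi_iff.2 fun i => hD.meas i
  induction t generalizing g with
  | zero => rfl
  | succ t ih =>
    have hinv : Measurable (inventory coord r 0 t) := measurable_inventory _ measurable_coord r 0 t
    have h1 := hD.lintegral_split t
      (f := fun a b => g (max (inventory coord r 0 t a + r - b 0) 0))
      (hg.comp ((((hinv.comp measurable_fst).add_const r).sub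
        ((measurable_pi_apply 0).comp measurable_snd)).max measurable_const))
      (fun a a' b h => by simp only [inventory_congr h])
    have h2 := hD.lintegral_split 1
      (f := fun a b => g (max (backInventory r t b + r - a 0) 0))
      (hg.comp (((((measurable_backInventory r t).comp measurable_snd).add_const r).sub
        ((measurable_pi_apply 0).comp measurable_fst)).max measurable_const))
      (fun a a' b h => by simp only [h 0 one_pos])
    simp only [← inventory_eq] at h1
    simp only [add_zero] at h1
    calc _ = ∫⁻ ω, ∫⁻ ω', g (max (inventory D r 0 t ω + r - D 0 ω') 0) ∂P ∂P := h1
      _ = ∫⁻ ω', ∫⁻ ω, g (max (inventory D r 0 t ω + r - D 0 ω') 0) ∂P ∂P := by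
        refine lintegral_lintegral_swap (Measurable.aemeasurable ?_)
        exact hg.comp (((((measurable_inventory D hD.meas r 0 t).comp measurable_fst).add_const
          r).sub ((hD.meas 0).comp measurable_snd)).max measurable_const)
      _ = ∫⁻ ω', ∫⁻ ω, g (max (backInventory r t (fun i => D i ω) + r - D 0 ω') 0) ∂P ∂P := by
        refine lintegral_congr fun ω' => ?_
        exact ih (g := fun z => g (max (z + r - D 0 ω') 0))
          (hg.comp (((measurable_id.add_const r).sub_const _).max measurable_const))
      _ = _ := h2.symm

/-! ### Exponential moments of the excess demand and of the walk -/

theorem excessLaw_isProbabilityMeasure {P : Measure Ω} [IsProbabilityMeasure P] {D : ℕ → Ω → ℝ}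
    (hD : Measurable (D 0)) (r : ℝ) : IsProbabilityMeasure (excessLaw P D r) :=
  Measure.isProbabilityMeasure_map (hD.sub_const r).aemeasurable

theorem ae_excessLaw {P : Measure Ω} {D : ℕ → Ω → ℝ} (hD : Measurable (D 0))
    (h0 : ∀ᵐ ω ∂P, 0 ≤ D 0 ω) (r : ℝ) : ∀ᵐ y ∂(excessLaw P D r), -r ≤ y := by
  rw [excessLaw, ae_map_iff (hD.sub_const r).aemeasurable measurableSet_Ici]
  filter_upwards [h0] with ω hω
  linarith

theorem integrable_exp_excessLaw {P : Measure Ω} [IsProbabilityMeasure P] {D : ℕ → Ω → ℝ}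
    (hD : Measurable (D 0)) (h0 : ∀ᵐ ω ∂P, 0 ≤ D 0 ω) (r : ℝ) {ε : ℝ} (hε : 0 < ε) :
    Integrable (fun y => Real.exp (-ε * y)) (excessLaw P D r) := by
  have := excessLaw_isProbabilityMeasure (P := P) hD r
  refine Integrable.of_bound (C := Real.exp (ε * r)) (by fun_prop) ?_
  filter_upwards [ae_excessLaw hD h0 r] with y hy
  rw [Real.norm_eq_abs, Real.abs_exp]
  exact Real.exp_le_exp.2 (by nlinarith)

theorem exp_neg_le_of_neg_one_le {u : ℝ} (hu : -1 ≤ u) : Real.exp (-u) ≤ 1 - u + u ^ 2 := by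
  rcases le_or_gt u 1 with h | h
  · have := (abs_le.1 (Real.abs_exp_sub_one_sub_id_le (x := -u)
      (abs_le.2 ⟨by linarith, by linarith⟩))).2
    nlinarith
  · have : Real.exp (-u) ≤ 1 := Real.exp_le_one_iff.2 (by linarith)
    nlinarith

/-- A law on `[-r, ∞)` with positive mean and finite second moment has `E[e^{-εY}] < 1` for some
`ε > 0`. -/
theorem exists_integral_exp_lt_one {F : Measure ℝ} [IsProbabilityMeasure F] {r : ℝ} (hr : 0 ≤ r)
    (hF : ∀ᵐ y ∂F, -r ≤ y) (h1 : Integrable (fun y => y) F) (h2 : Integrable (fun y => y ^ 2) F)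
    (hm : 0 < ∫ y, y ∂F) : ∃ ε : ℝ, 0 < ε ∧ ∫ y, Real.exp (-ε * y) ∂F < 1 := by
  set m := ∫ y, y ∂F
  set q := ∫ y, y ^ 2 ∂F
  have hq : 0 ≤ q := integral_nonneg fun y => sq_nonneg y
  -- The first bound gives `ε * y ≥ -1` on the support, so the quadratic bound for the exponential
  -- applies; the second makes `ε ^ 2 * q` smaller than `ε * m`. Adding `1` avoids division by zero.
  set ε := min (1 / (r + 1)) (m / (2 * (q + 1)))
  have hε : 0 < ε := lt_min (by positivity) (by positivity)
  have hεr : ε * r ≤ 1 := by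
    have : ε * (r + 1) ≤ 1 := by
      rw [← le_div_iff₀ (by positivity)]
      exact min_le_left _ _
    linarith
  have hεq : ε * (q + 1) ≤ m / 2 := by
    have : ε ≤ m / (2 * (q + 1)) := min_le_right _ _
    rw [le_div_iff₀ (by positivity)] at this
    linarith
  refine ⟨ε, hε, ?_⟩
  have hint : Integrable (fun y => 1 - ε * y + ε ^ 2 * y ^ 2) F :=
    ((integrable_const _).sub (h1.const_mul _)).add (h2.const_mul _)
  calc ∫ y, Real.exp (-ε * y) ∂F ≤ ∫ y, 1 - ε * y + ε ^ 2 * y ^ 2 ∂F := by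
        refine integral_mono_of_nonneg (ae_of_all _ fun y => (Real.exp_pos _).le) hint ?_
        filter_upwards [hF] with y hy
        have := exp_neg_le_of_neg_one_le (u := ε * y) (by nlinarith)
        rw [neg_mul]
        linarith [mul_pow ε y 2]
    _ = 1 - ε * m + ε ^ 2 * q := by
        have h3 : Integrable (fun y => 1 - ε * y) F := (integrable_const _).sub (h1.const_mul _)
        rw [integral_add h3 (h2.const_mul _), integral_sub (integrable_const _) (h1.const_mul _),
          integral_const_mul, integral_const_mul]
        simp [m, q]
    _ < 1 := by nlinarith

theorem IsIID.lintegral_exp_walk {P : Measure Ω} [IsProbabilityMeasure P] {D : ℕ → Ω → ℝ}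
    (hD : IsIID P D) (r ε : ℝ) (t : ℕ) :
    ∫⁻ ω, ENNReal.ofReal (Real.exp (-ε * walk D r t ω)) ∂P =
      (∫⁻ y, ENNReal.ofReal (Real.exp (-ε * y)) ∂(excessLaw P D r)) ^ t := by
  induction t with
  | zero => simp [walk_zero]
  | succ t ih =>
    have hf : Measurable (fun y : ℝ => ENNReal.ofReal (Real.exp (-ε * y))) := by fun_prop
    have h := hD.lintegral_split t
      (f := fun a b => ENNReal.ofReal (Real.exp (-ε * walk coord r t a)) *
        ENNReal.ofReal (Real.exp (-ε * (b 0 - r))))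
      ((hf.comp ((measurable_walk coord measurable_coord r t).comp measurable_fst)).mul
        (hf.comp (Measurable.sub_const (by fun_prop) r)))
      (fun a a' b h => by simp only [walk_congr h])
    simp only [← walk_eq D, add_zero] at h
    have h0 : ∫⁻ ω, ENNReal.ofReal (Real.exp (-ε * (D 0 ω - r))) ∂P =
        ∫⁻ y, ENNReal.ofReal (Real.exp (-ε * y)) ∂(excessLaw P D r) := by
      rw [excessLaw, lintegral_map hf ((hD.meas 0).sub_const r)]
    calc _ = ∫⁻ ω, ENNReal.ofReal (Real.exp (-ε * walk D r t ω)) *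
        ENNReal.ofReal (Real.exp (-ε * (D t ω - r))) ∂P := by
          refine lintegral_congr fun ω => ?_
          rw [walk_succ, mul_add, Real.exp_add, ENNReal.ofReal_mul (Real.exp_pos _).le]
      _ = _ := by
          rw [h]
          have h0m : Measurable fun ω => ENNReal.ofReal (Real.exp (-ε * (D 0 ω - r))) :=
            hf.comp ((hD.meas 0).sub_const r)
          have hwm : Measurable fun ω => ENNReal.ofReal (Real.exp (-ε * walk D r t ω)) :=
            hf.comp (measurable_walk D hD.meas r t)
          simp_rw [lintegral_const_mul _ h0m]
          rw [lintegral_mul_const _ hwm, ih, h0, pow_succ]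

/-- A geometric series. No condition on `ε` is needed: if the ratio is at least `1`, truncated
subtraction makes the right side infinite, as it should be. -/
theorem IsIID.tsum_lintegral_exp {P : Measure Ω} [IsProbabilityMeasure P] {D : ℕ → Ω → ℝ}
    (hD : IsIID P D) (r ε y : ℝ) :
    ∑' t, ∫⁻ ω, ENNReal.ofReal (Real.exp (ε * (y - walk D r t ω))) ∂P =
      ENNReal.ofReal (Real.exp (ε * y)) *
        (1 - ∫⁻ y, ENNReal.ofReal (Real.exp (-ε * y)) ∂(excessLaw P D r))⁻¹ := by
  rw [← ENNReal.tsum_geometric, ← ENNReal.tsum_mul_left]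
  refine tsum_congr fun t => ?_
  rw [← hD.lintegral_exp_walk, ← lintegral_const_mul]
  · refine lintegral_congr fun ω => ?_
    rw [← ENNReal.ofReal_mul (Real.exp_pos _).le, ← Real.exp_add]
    congr 2
    ring
  · exact ENNReal.measurable_ofReal.comp (Real.measurable_exp.comp
      ((measurable_walk D hD.meas r t).const_mul _))

/-! ### Passage times and total excess inventory -/

/-- The number of periods in which the running maximum is at most `y`. -/
noncomputable def occupation (r y : ℝ) (d : ℕ → ℝ) : ℝ≥0∞ :=
  ∑' t, if runMax coord r t d ≤ y then 1 else 0

theorem measurable_occupation (r : ℝ) : Measurable (fun q : ℝ × (ℕ → ℝ) => occupation r q.1 q.2) :=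
  Measurable.tsum fun t => Measurable.ite (measurableSet_le
    ((measurable_runMax _ measurable_coord r t).comp measurable_snd) measurable_fst)
    measurable_const measurable_const

/-- The mean number of periods in which the running maximum is at most `y`. -/
noncomputable def meanPassage (P : Measure Ω) (D : ℕ → Ω → ℝ) (r y : ℝ) : ℝ≥0∞ :=
  ∑' t, P {ω | runMax D r t ω ≤ y}

theorem meanPassage_eq_lintegral {P : Measure Ω} {D : ℕ → Ω → ℝ} (hD : IsIID P D) (r y : ℝ) :
    meanPassage P D r y = ∫⁻ ω, occupation r y (fun i => D i ω) ∂P := by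
  have hm : ∀ t, MeasurableSet {ω | runMax D r t ω ≤ y} := fun t =>
    measurableSet_le (measurable_runMax D hD.meas r t) measurable_const
  simp only [occupation, ← runMax_eq]
  rw [lintegral_tsum fun t => (Measurable.ite (hm t) measurable_const
    measurable_const).aemeasurable, meanPassage]
  refine tsum_congr fun t => ?_
  rw [← lintegral_indicator_one (hm t)]
  rfl

theorem measurable_meanPassage {P : Measure Ω} [IsProbabilityMeasure P] {D : ℕ → Ω → ℝ}
    (hD : IsIID P D) (r : ℝ) : Measurable (meanPassage P D r) := by
  have h : meanPassage P D r = fun y => ∫⁻ ω, occupation r y (fun i => D i ω) ∂P :=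
    funext fun y => meanPassage_eq_lintegral hD r y
  rw [h]
  exact ((measurable_occupation r).comp (measurable_fst.prodMk
    ((measurable_pi_iff.2 fun i => hD.meas i).comp measurable_snd))).lintegral_prod_right'

theorem meanPassage_mono (P : Measure Ω) (D : ℕ → Ω → ℝ) (r : ℝ) :
    Monotone (meanPassage P D r) := fun _ _ h =>
  ENNReal.tsum_le_tsum fun _ => measure_mono fun _ hω => le_trans hω h

theorem meanPassage_of_neg (P : Measure Ω) (D : ℕ → Ω → ℝ) (r : ℝ) {y : ℝ} (hy : y < 0) :
    meanPassage P D r y = 0 := by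
  rw [meanPassage, ENNReal.tsum_eq_zero]
  intro t
  convert measure_empty (μ := P)
  ext ω
  simpa using hy.trans_le (runMax_nonneg D r t ω)

theorem lintegral_exp_lt_one {F : Measure ℝ} {ε : ℝ}
    (hint : Integrable (fun y => Real.exp (-ε * y)) F)
    (h : ∫ y, Real.exp (-ε * y) ∂F < 1) :
    ∫⁻ y, ENNReal.ofReal (Real.exp (-ε * y)) ∂F < 1 := by
  rw [← ofReal_integral_eq_lintegral_ofReal hint (ae_of_all _ fun y => (Real.exp_pos _).le)]
  exact ENNReal.ofReal_lt_one.2 h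

/-- Chernoff's bound: `M_t ≤ y` forces `S_t ≤ y`, and then `1 ≤ e^{ε(y - S_t)}`. -/
theorem IsIID.meanPassage_le {P : Measure Ω} [IsProbabilityMeasure P] {D : ℕ → Ω → ℝ}
    (hD : IsIID P D) (r : ℝ) {ε : ℝ} (hε : 0 < ε) (y : ℝ) :
    meanPassage P D r y ≤ ENNReal.ofReal (Real.exp (ε * y)) *
        (1 - ∫⁻ y, ENNReal.ofReal (Real.exp (-ε * y)) ∂(excessLaw P D r))⁻¹ := by
  rw [← hD.tsum_lintegral_exp]
  refine ENNReal.tsum_le_tsum fun t => ?_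
  rw [← lintegral_indicator_one
    (measurableSet_le (measurable_runMax D hD.meas r t) measurable_const)]
  refine lintegral_mono fun ω => ?_
  by_cases h : runMax D r t ω ≤ y
  · have h1 := (walk_le_runMax D r t ω).trans h
    rw [indicator_of_mem (by exact h), Pi.one_apply, ENNReal.one_le_ofReal, Real.one_le_exp_iff]
    nlinarith
  · rw [indicator_of_notMem (by exact h)]
    exact zero_le

/-- The total mean excess inventory `∑_t E[(x - max_{s ≤ t} S_s)^+]` caused by the initial level
`x`. -/
noncomputable def meanGain (P : Measure Ω) (D : ℕ → Ω → ℝ) (r x : ℝ) : ℝ≥0∞ :=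
  ∑' t, ∫⁻ ω, ENNReal.ofReal (x - runMax D r t ω) ∂P

/-- The same bound with `u ≤ ε⁻¹ e^{εu}` at `u = y - S_t`, where `y` is the initial level. -/
theorem IsIID.meanGain_le {P : Measure Ω} [IsProbabilityMeasure P] {D : ℕ → Ω → ℝ}
    (hD : IsIID P D) (r : ℝ) {ε : ℝ} (hε : 0 < ε) (x : ℝ) :
    meanGain P D r x ≤ ENNReal.ofReal ε⁻¹ * (ENNReal.ofReal (Real.exp (ε * x)) *
        (1 - ∫⁻ y, ENNReal.ofReal (Real.exp (-ε * y)) ∂(excessLaw P D r))⁻¹) := by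
  rw [← hD.tsum_lintegral_exp, ← ENNReal.tsum_mul_left]
  refine ENNReal.tsum_le_tsum fun t => ?_
  have hw := measurable_walk D hD.meas r t
  rw [← lintegral_const_mul _ (by fun_prop)]
  refine lintegral_mono fun ω => ?_
  rw [← ENNReal.ofReal_mul (by positivity)]
  refine ENNReal.ofReal_le_ofReal ?_
  have h1 := walk_le_runMax D r t ω
  have h2 := Real.add_one_le_exp (ε * (x - walk D r t ω))
  rw [inv_mul_eq_div, le_div_iff₀ hε]
  nlinarith

theorem meanGain_mono (P : Measure Ω) (D : ℕ → Ω → ℝ) (r : ℝ) :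
    Monotone (meanGain P D r) := fun _ _ h =>
  ENNReal.tsum_le_tsum fun _ => lintegral_mono fun _ =>
    ENNReal.ofReal_le_ofReal (sub_le_sub_right h _)

/-- Layer-cake: `(x - M_t)^+` is the length of the set of `y ∈ [0, x]` with `M_t ≤ y`, because `M_t
≥ 0`. -/
theorem IsIID.meanGain_eq {P : Measure Ω} [IsProbabilityMeasure P] {D : ℕ → Ω → ℝ}
    (hD : IsIID P D) (r x : ℝ) :
    meanGain P D r x = ∫⁻ y in Icc 0 x, meanPassage P D r y := by
  have hm : ∀ t, MeasurableSet {q : ℝ × Ω | runMax D r t q.2 ≤ q.1} := fun t =>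
    measurableSet_le ((measurable_runMax D hD.meas r t).comp measurable_snd) measurable_fst
  simp only [meanPassage]
  have hP : ∀ t, Measurable fun y => P {ω | runMax D r t ω ≤ y} := fun t =>
    measurable_measure_prodMk_left (hm t)
  rw [lintegral_tsum fun t => (hP t).aemeasurable, meanGain]
  refine tsum_congr fun t => ?_
  have hω : ∀ ω, ENNReal.ofReal (x - runMax D r t ω) =
      ∫⁻ y in Icc 0 x, {q : ℝ × Ω | runMax D r t q.2 ≤ q.1}.indicator 1 (y, ω) := by
    intro ω
    have : (fun y : ℝ => {q : ℝ × Ω | runMax D r t q.2 ≤ q.1}.indicator (1 : ℝ × Ω → ℝ≥0∞) (y, ω))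
        = (Ici (runMax D r t ω)).indicator 1 := rfl
    rw [this, lintegral_indicator_one measurableSet_Ici,
      Measure.restrict_apply measurableSet_Ici, ← Real.volume_Icc]
    congr 1
    ext y
    have := runMax_nonneg D r t ω
    simp only [mem_Icc, mem_inter_iff, mem_Ici]
    exact ⟨fun h => ⟨h.1, by linarith, h.2⟩, fun h => ⟨h.1, h.2.2⟩⟩
  simp_rw [hω]
  rw [lintegral_lintegral_swap]
  · refine lintegral_congr fun y => ?_
    rw [← lintegral_indicator_one (measurableSet_le (measurable_runMax D hD.meas r t)
      measurable_const)]
    rfl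
  · exact ((measurable_one.indicator (hm t)).comp
      (measurable_snd.prodMk measurable_fst)).aemeasurable

/-! ### Ladder epochs and ladder heights -/

/-- The event `τ_+ > t`. -/
def noLadder {Ω : Type*} (D : ℕ → Ω → ℝ) (r : ℝ) (t : ℕ) : Set Ω :=
  {ω | ∀ s, 0 < s → s ≤ t → walk D r s ω < 0}

/-- The event `τ_+ = k + 1`. -/
def firstLadder {Ω : Type*} (D : ℕ → Ω → ℝ) (r : ℝ) (k : ℕ) : Set Ω :=
  noLadder D r k ∩ {ω | 0 ≤ walk D r (k + 1) ω}

theorem noLadder_anti {Ω : Type*} (D : ℕ → Ω → ℝ) (r : ℝ) : Antitone (noLadder D r) :=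
  fun _ _ h _ hω s h0 hs => hω s h0 (hs.trans h)

theorem noLadder_zero {Ω : Type*} (D : ℕ → Ω → ℝ) (r : ℝ) : noLadder D r 0 = univ :=
  eq_univ_of_forall fun _ s h0 hs => by omega

theorem measurableSet_noLadder (D : ℕ → Ω → ℝ) (hD : ∀ t, Measurable (D t)) (r : ℝ) (t : ℕ) :
    MeasurableSet (noLadder D r t) := by
  simp only [noLadder, ofPred_forall]
  exact MeasurableSet.iInter fun s => MeasurableSet.iInter fun _ => MeasurableSet.iInter fun _ =>
    measurableSet_lt (measurable_walk D hD r s) measurable_const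

theorem measurableSet_firstLadder (D : ℕ → Ω → ℝ) (hD : ∀ t, Measurable (D t)) (r : ℝ) (k : ℕ) :
    MeasurableSet (firstLadder D r k) :=
  (measurableSet_noLadder D hD r k).inter
    (measurableSet_le measurable_const (measurable_walk D hD r (k + 1)))

theorem noLadder_congr {r : ℝ} {t : ℕ} {a b : ℕ → ℝ} (h : ∀ i < t, a i = b i) :
    a ∈ noLadder coord r t ↔ b ∈ noLadder coord r t :=
  forall_congr' fun s => forall_congr' fun _ => forall_congr' fun hs => by
    rw [walk_congr fun i hi => h i (hi.trans_le hs)]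

theorem firstLadder_congr {r : ℝ} {k : ℕ} {a b : ℕ → ℝ} (h : ∀ i < k + 1, a i = b i) :
    a ∈ firstLadder coord r k ↔ b ∈ firstLadder coord r k :=
  and_congr (noLadder_congr fun i hi => h i (by omega)) (by
    simp only [mem_ofPred_eq]; rw [walk_congr h])

theorem ladderTime_of_firstLadder {Ω : Type*} {D : ℕ → Ω → ℝ} {r : ℝ} {k : ℕ} {ω : Ω}
    (h : ω ∈ firstLadder D r k) : ladderTime D r ω = k + 1 := by
  have hmem : k + 1 ∈ {t : ℕ | 0 < t ∧ 0 ≤ walk D r t ω} := ⟨Nat.succ_pos k, h.2⟩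
  refine le_antisymm (Nat.sInf_le hmem) (le_csInf ⟨_, hmem⟩ fun s hs => ?_)
  by_contra hlt
  exact absurd (h.1 s hs.1 (by omega)) (not_lt.2 hs.2)

theorem ladderEvent_eq_iUnion {Ω : Type*} (D : ℕ → Ω → ℝ) (r : ℝ) :
    ladderEvent D r = ⋃ k, firstLadder D r k := by
  ext ω
  simp only [mem_iUnion]
  constructor
  · intro h
    have hs := Nat.sInf_mem (s := {t : ℕ | 0 < t ∧ 0 ≤ walk D r t ω}) h
    obtain ⟨k, hk⟩ := Nat.exists_eq_succ_of_ne_zero hs.1.ne'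
    refine ⟨k, fun s h0 hsk => ?_, ?_⟩
    · by_contra hlt
      have := Nat.sInf_le (s := {t : ℕ | 0 < t ∧ 0 ≤ walk D r t ω}) ⟨h0, not_lt.1 hlt⟩
      omega
    · rw [hk] at hs
      exact hs.2
  · rintro ⟨k, hk⟩
    exact ⟨k + 1, Nat.succ_pos k, hk.2⟩

theorem firstLadder_disjoint {Ω : Type*} (D : ℕ → Ω → ℝ) (r : ℝ) :
    Pairwise (Function.onFun Disjoint (firstLadder D r)) := by
  intro i j hij
  refine Set.disjoint_left.2 fun ω hi hj => hij ?_
  have := (ladderTime_of_firstLadder hi).symm.trans (ladderTime_of_firstLadder hj)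
  omega

theorem measurable_ladderTime (D : ℕ → Ω → ℝ) (hD : ∀ t, Measurable (D t)) (r : ℝ) :
    Measurable (ladderTime D r) := by
  refine measurable_to_countable' fun k => ?_
  have hsucc : ∀ k, ladderTime D r ⁻¹' {k + 1} = firstLadder D r k := by
    intro k
    ext ω
    refine ⟨fun h => ?_, fun h => ladderTime_of_firstLadder h⟩
    have h' : ladderTime D r ω = k + 1 := h
    have hω : ω ∈ ladderEvent D r := Nat.nonempty_of_sInf_eq_succ h'
    rw [ladderEvent_eq_iUnion, mem_iUnion] at hω
    obtain ⟨j, hj⟩ := hω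
    have := ladderTime_of_firstLadder hj
    rwa [show k = j by omega]
  cases k with
  | zero =>
    -- The value `0` is the default `sInf ∅`, taken exactly where the walk never returns to `[0,
    -- ∞)`.
    have : ladderTime D r ⁻¹' {0} = (⋃ k, ladderTime D r ⁻¹' {k + 1})ᶜ := by
      ext ω
      simp only [mem_preimage, mem_singleton_iff, mem_compl_iff, mem_iUnion, not_exists]
      constructor
      · intro h k
        omega
      · intro h
        by_contra h0
        exact h (ladderTime D r ω - 1) (by omega)
    rw [this]
    simp only [hsucc]
    exact (MeasurableSet.iUnion fun k => measurableSet_firstLadder D hD r k).compl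
  | succ k =>
    rw [hsucc]
    exact measurableSet_firstLadder D hD r k

theorem measurable_ladderHeight (D : ℕ → Ω → ℝ) (hD : ∀ t, Measurable (D t)) (r : ℝ) :
    Measurable (fun ω => walk D r (ladderTime D r ω) ω) := by
  have h : Measurable (fun q : ℕ × Ω => walk D r q.1 q.2) :=
    measurable_from_prod_countable_right fun t => measurable_walk D hD r t
  exact h.comp ((measurable_ladderTime D hD r).prodMk measurable_id)

theorem lintegral_ladderLaw (P : Measure Ω) (D : ℕ → Ω → ℝ) (hD : ∀ t, Measurable (D t)) (r : ℝ)
    {g : ℝ → ℝ≥0∞} (hg : Measurable g) :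
    ∫⁻ z, g z ∂(ladderLaw P D r) = ∑' k, ∫⁻ ω in firstLadder D r k, g (walk D r (k + 1) ω) ∂P := by
  rw [ladderLaw, lintegral_map hg (measurable_ladderHeight D hD r), ladderEvent_eq_iUnion,
    lintegral_iUnion (fun k => measurableSet_firstLadder D hD r k) (firstLadder_disjoint D r)]
  refine tsum_congr fun k => setLIntegral_congr_fun (measurableSet_firstLadder D hD r k) ?_
  intro ω hω
  simp only [ladderTime_of_firstLadder hω]

instance (P : Measure Ω) [IsProbabilityMeasure P] (D : ℕ → Ω → ℝ) (r : ℝ) :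
    IsFiniteMeasure (ladderLaw P D r) := by
  rw [ladderLaw]
  infer_instance

theorem ladderLaw_Iio_zero (P : Measure Ω) (D : ℕ → Ω → ℝ) (hD : ∀ t, Measurable (D t)) (r : ℝ) :
    ladderLaw P D r (Iio 0) = 0 := by
  rw [← lintegral_indicator_one measurableSet_Iio, lintegral_ladderLaw P D hD r
    (measurable_one.indicator measurableSet_Iio), ENNReal.tsum_eq_zero]
  intro k
  rw [setLIntegral_congr_fun (g := fun _ => 0) (measurableSet_firstLadder D hD r k), lintegral_zero]
  intro ω hω
  have h : walk D r (k + 1) ω ∉ Iio 0 := notMem_Iio.2 hω.2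
  simp [h]

/-- The mean ladder period `E[τ_+]`. -/
noncomputable def meanLadderTime (P : Measure Ω) (D : ℕ → Ω → ℝ) (r : ℝ) : ℝ≥0∞ :=
  ∑' t, P (noLadder D r t)

theorem one_le_meanLadderTime (P : Measure Ω) [IsProbabilityMeasure P] (D : ℕ → Ω → ℝ) (r : ℝ) :
    1 ≤ meanLadderTime P D r := by
  refine le_trans ?_ (ENNReal.le_tsum 0)
  rw [noLadder_zero, measure_univ]

theorem runMax_le_zero_of_noLadder {Ω : Type*} {D : ℕ → Ω → ℝ} {r : ℝ} {t : ℕ} {ω : Ω}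
    (h : ω ∈ noLadder D r t) : runMax D r t ω ≤ 0 := by
  refine (runMax_le_iff D r t ω 0).2 fun s hs => ?_
  rcases Nat.eq_zero_or_pos s with rfl | h0
  · rw [walk_zero]
  · exact (h s h0 hs).le

theorem meanLadderTime_le (P : Measure Ω) (D : ℕ → Ω → ℝ) (r : ℝ) :
    meanLadderTime P D r ≤ meanPassage P D r 0 :=
  ENNReal.tsum_le_tsum fun _ => measure_mono fun _ h => runMax_le_zero_of_noLadder h

/-- `P(τ_+ = ∞) ≤ P(τ_+ > t)`, and the latter is the general term of a convergent series. -/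
theorem ae_ladderEvent {P : Measure Ω} {D : ℕ → Ω → ℝ} {r : ℝ}
    (h : meanLadderTime P D r ≠ ∞) : ∀ᵐ ω ∂P, ω ∈ ladderEvent D r := by
  have hlim := ENNReal.tendsto_atTop_zero_of_tsum_ne_top h
  rw [ae_iff]
  refine le_antisymm (ge_of_tendsto' hlim fun t => measure_mono fun ω hω s h0 _ => ?_) zero_le
  by_contra hlt
  exact hω ⟨s, h0, not_lt.1 hlt⟩

/-! ### The renewal equation and Wald's identities -/

/-- Before the ladder epoch `k + 1` the running maximum is `0`, so all of these `k + 1` periods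
count. From then on it is the ladder height plus the running maximum of the restarted walk. -/
theorem occupation_of_firstLadder {r y : ℝ} (hy : 0 ≤ y) {k : ℕ} {d : ℕ → ℝ}
    (h : d ∈ firstLadder coord r k) :
    occupation r y d = (∑' t, (noLadder coord r t).indicator 1 d) +
      occupation r (y - walk coord r (k + 1) d) (fun i => d (k + 1 + i)) := by
  have hno : ∀ t, k + 1 ≤ t → d ∉ noLadder coord r t := fun t ht hd =>
    absurd (hd (k + 1) (Nat.succ_pos k) ht) (not_lt.2 h.2)
  have hyes : ∀ t, t < k + 1 → d ∈ noLadder coord r t := fun t ht =>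
    noLadder_anti coord r (Nat.le_of_lt_succ ht) h.1
  have h1 : ∑' t, (noLadder coord r t).indicator (1 : (ℕ → ℝ) → ℝ≥0∞) d =
      ∑ t ∈ Finset.range (k + 1), (noLadder coord r t).indicator 1 d :=
    tsum_eq_sum fun t ht => indicator_of_notMem (hno t (by simpa using ht)) _
  rw [h1, occupation, ← Summable.sum_add_tsum_nat_add' (k := k + 1) ENNReal.summable, occupation]
  congr 1
  · refine Finset.sum_congr rfl fun t ht => ?_
    have := hyes t (Finset.mem_range.1 ht)
    rw [indicator_of_mem this, if_pos ((runMax_le_zero_of_noLadder this).trans hy), Pi.one_apply]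
  · refine tsum_congr fun j => if_congr ?_ rfl rfl
    rw [runMax_le_iff, runMax_le_iff, add_comm j]
    constructor
    · intro H i hi
      have := H (k + 1 + i) (by omega)
      rw [walk_add] at this
      linarith
    · intro H s hs
      rcases Nat.lt_or_ge s (k + 1) with hlt | hge
      · rcases Nat.eq_zero_or_pos s with rfl | h0
        · rwa [walk_zero]
        · exact (hyes s hlt s h0 le_rfl).le.trans hy
      · obtain ⟨i, rfl⟩ := Nat.exists_eq_add_of_le hge
        have := H i (by omega)
        rw [walk_add]
        linarith

/-- The renewal equation of the mean passage time. -/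
theorem IsIID.meanPassage_renewal {P : Measure Ω} [IsProbabilityMeasure P] {D : ℕ → Ω → ℝ}
    (hD : IsIID P D) {r : ℝ} (hfin : meanLadderTime P D r ≠ ∞) {y : ℝ} (hy : 0 ≤ y) :
    meanPassage P D r y =
      meanLadderTime P D r + ∫⁻ z, meanPassage P D r (y - z) ∂(ladderLaw P D r) := by
  have hI : Measurable (fun ω i => D i ω) := measurable_pi_iff.2 fun i => hD.meas i
  have hm : Measurable fun ω => ∑' t, (noLadder D r t).indicator (1 : Ω → ℝ≥0∞) ω :=
    Measurable.tsum fun t => measurable_one.indicator (measurableSet_noLadder D hD.meas r t)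
  have hF := fun k => measurableSet_firstLadder D hD.meas r k
  have hae : ∀ f : Ω → ℝ≥0∞, ∫⁻ ω, f ω ∂P = ∑' k, ∫⁻ ω in firstLadder D r k, f ω ∂P := by
    intro f
    rw [← lintegral_iUnion hF (firstLadder_disjoint D r), ← ladderEvent_eq_iUnion,
      Measure.restrict_eq_self_of_ae_mem (ae_ladderEvent hfin)]
  have hmeas : Measurable fun z => meanPassage P D r (y - z) :=
    (measurable_meanPassage hD r).comp (measurable_const.sub measurable_id)
  rw [meanPassage_eq_lintegral hD, hae, lintegral_ladderLaw P D hD.meas r hmeas]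
  have he : meanLadderTime P D r =
      ∫⁻ ω, ∑' t, (noLadder D r t).indicator (1 : Ω → ℝ≥0∞) ω ∂P := by
    rw [lintegral_tsum fun t => (measurable_one.indicator
      (measurableSet_noLadder D hD.meas r t)).aemeasurable]
    exact tsum_congr fun t =>
      (lintegral_indicator_one (measurableSet_noLadder D hD.meas r t)).symm
  rw [he, hae, ← ENNReal.tsum_add]
  refine tsum_congr fun k => ?_
  -- The event `τ_+ = k + 1` and the ladder height depend on the first `k + 1` demands only; the
  -- restarted walk is a fresh copy.
  have hsplit := hD.lintegral_split (k + 1)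
    (f := fun a b => (firstLadder coord r k).indicator 1 a *
      occupation r (y - walk coord r (k + 1) a) b)
    (((measurable_one.indicator (measurableSet_firstLadder _ measurable_coord r k)).comp
      measurable_fst).mul ((measurable_occupation r).comp ((measurable_const.sub
        ((measurable_walk _ measurable_coord r (k + 1)).comp measurable_fst)).prodMk
          measurable_snd)))
    (fun a a' b h => by
      have hind := indicator_eq_indicator (f := (1 : (ℕ → ℝ) → ℝ≥0∞))
        (g := (1 : (ℕ → ℝ) → ℝ≥0∞)) (firstLadder_congr (r := r) h) rfl
      simp only [walk_congr h, hind])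
  have hmul : ∀ f : Ω → ℝ≥0∞, ∫⁻ ω in firstLadder D r k, f ω ∂P =
      ∫⁻ ω, (firstLadder coord r k).indicator 1 (fun i => D i ω) * f ω ∂P := by
    intro f
    rw [← lintegral_indicator (hF k)]
    refine lintegral_congr fun ω => ?_
    by_cases h : ω ∈ firstLadder D r k
    · have h' : (fun i => D i ω) ∈ firstLadder coord r k := h
      simp [h, h']
    · have h' : (fun i => D i ω) ∉ firstLadder coord r k := h
      simp [h, h']
  have hocc : ∀ z, Measurable fun ω => occupation r z (fun i => D i ω) := fun z =>
    (measurable_occupation r).comp (measurable_const.prodMk hI)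
  calc ∫⁻ ω in firstLadder D r k, occupation r y (fun i => D i ω) ∂P
      = ∫⁻ ω in firstLadder D r k, (∑' t, (noLadder D r t).indicator 1 ω) +
          occupation r (y - walk D r (k + 1) ω) (fun i => D (k + 1 + i) ω) ∂P :=
        setLIntegral_congr_fun (hF k) fun ω hω => occupation_of_firstLadder hy hω
    _ = ∫⁻ ω in firstLadder D r k, ∑' t, (noLadder D r t).indicator 1 ω ∂P +
          ∫⁻ ω in firstLadder D r k,
            occupation r (y - walk D r (k + 1) ω) (fun i => D (k + 1 + i) ω) ∂P :=
        lintegral_add_left hm _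
    _ = _ := by
        congr 1
        rw [hmul, hmul]
        refine hsplit.trans (lintegral_congr fun ω => ?_)
        rw [lintegral_const_mul _ (hocc _), ← meanPassage_eq_lintegral hD]
        rfl

instance (P : Measure Ω) [IsProbabilityMeasure P] (D : ℕ → Ω → ℝ) (r : ℝ) (n : ℕ) :
    IsFiniteMeasure (convPow (ladderLaw P D r) n) := by
  induction n with
  | zero => rw [convPow]; infer_instance
  | succ n ih => rw [convPow]; infer_instance

theorem ae_nonneg_of_Iio_zero {G : Measure ℝ} (hG : G (Iio 0) = 0) : ∀ᵐ z ∂G, 0 ≤ z := by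
  filter_upwards [measure_eq_zero_iff_ae_notMem.1 hG] with z hz
  exact notMem_Iio.1 hz

theorem convPow_Iio_zero {G : Measure ℝ} [SFinite G] (hG : G (Iio 0) = 0) (n : ℕ) :
    convPow G n (Iio 0) = 0 := by
  have hae := ae_nonneg_of_Iio_zero hG
  induction n with
  | zero => simp [convPow]
  | succ n ih =>
    have hae' := ae_nonneg_of_Iio_zero ih
    rw [convPow, ← lintegral_indicator_one measurableSet_Iio, Measure.lintegral_conv
      (measurable_one.indicator measurableSet_Iio)]
    refine (lintegral_congr_ae (g := fun _ => 0) ?_).trans lintegral_zero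
    filter_upwards [hae'] with z hz
    refine (lintegral_congr_ae (g := fun _ => 0) ?_).trans lintegral_zero
    filter_upwards [hae] with w hw
    exact indicator_of_notMem (notMem_Iio.2 (add_nonneg hz hw)) _

/-- The iterated renewal equation. -/
theorem IsIID.meanPassage_iterate {P : Measure Ω} [IsProbabilityMeasure P] {D : ℕ → Ω → ℝ}
    (hD : IsIID P D) {r : ℝ} (hfin : meanLadderTime P D r ≠ ∞) (y : ℝ) (n : ℕ) :
    meanPassage P D r y =
      meanLadderTime P D r * ∑ k ∈ Finset.range n, convPow (ladderLaw P D r) k (Iic y) +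
        ∫⁻ z, meanPassage P D r (y - z) ∂(convPow (ladderLaw P D r) n) := by
  have hmeas := measurable_meanPassage hD r
  -- With the indicator, the renewal equation holds for all real `u`: both sides vanish for `u < 0`.
  -- Iteration needs this, as `y - z` may be negative.
  have hstep : ∀ u, meanPassage P D r u = (Ici 0).indicator (fun _ => meanLadderTime P D r) u +
      ∫⁻ z, meanPassage P D r (u - z) ∂(ladderLaw P D r) := by
    intro u
    rcases le_or_gt 0 u with hu | hu
    · rw [indicator_of_mem (by exact hu), ← hD.meanPassage_renewal hfin hu]
    · rw [indicator_of_notMem (by exact not_le.2 hu), zero_add, meanPassage_of_neg P D r hu]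
      refine ((lintegral_congr_ae (g := fun _ => 0) ?_).trans lintegral_zero).symm
      filter_upwards [ae_nonneg_of_Iio_zero (ladderLaw_Iio_zero P D hD.meas r)] with z hz
      exact meanPassage_of_neg P D r (by linarith)
  induction n with
  | zero => simp [convPow, lintegral_dirac]
  | succ n ih =>
    have hmeas' : Measurable fun z => meanPassage P D r (y - z) :=
      hmeas.comp (measurable_const.sub measurable_id)
    have hconv := Measure.lintegral_conv (μ := convPow (ladderLaw P D r) n)
      (ν := ladderLaw P D r) hmeas'
    rw [ih, Finset.sum_range_succ, mul_add, add_assoc]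
    congr 1
    rw [convPow, hconv]
    have hind : Measurable fun z : ℝ =>
        (Ici 0).indicator (fun _ => meanLadderTime P D r) (y - z) :=
      (measurable_const.indicator measurableSet_Ici).comp (measurable_const.sub measurable_id)
    calc ∫⁻ z, meanPassage P D r (y - z) ∂(convPow (ladderLaw P D r) n)
        = ∫⁻ z, (Ici 0).indicator (fun _ => meanLadderTime P D r) (y - z) +
            ∫⁻ w, meanPassage P D r (y - (z + w)) ∂(ladderLaw P D r)
              ∂(convPow (ladderLaw P D r) n) := by
          refine lintegral_congr fun z => ?_
          simp only [← sub_sub]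
          exact hstep (y - z)
      _ = _ := by
          rw [lintegral_add_left hind]
          congr 1
          have : (fun z : ℝ => (Ici 0).indicator (fun _ => meanLadderTime P D r) (y - z)) =
              (Iic y).indicator fun _ => meanLadderTime P D r := by
            funext z
            simp [indicator, mem_Ici, mem_Iic]
          rw [this, lintegral_indicator_const measurableSet_Iic]

theorem renewalMeasure_Iic (P : Measure Ω) (D : ℕ → Ω → ℝ) (r y : ℝ) :
    renewalMeasure P D r (Iic y) = ∑' n, convPow (ladderLaw P D r) n (Iic y) := by
  rw [renewalMeasure, Measure.sum_apply _ measurableSet_Iic]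

/-- Drops the nonnegative remainder of the iterated renewal equation; finiteness of `U_+` follows.
-/
theorem IsIID.renewal_le {P : Measure Ω} [IsProbabilityMeasure P] {D : ℕ → Ω → ℝ}
    (hD : IsIID P D) {r : ℝ} (hfin : meanLadderTime P D r ≠ ∞) (y : ℝ) :
    meanLadderTime P D r * renewalMeasure P D r (Iic y) ≤ meanPassage P D r y := by
  rw [renewalMeasure_Iic, ← ENNReal.tsum_mul_left]
  refine ENNReal.tsum_le_of_sum_range_le fun n => ?_
  rw [← Finset.mul_sum, hD.meanPassage_iterate hfin y n]
  exact le_self_add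

/-- Wald's identity `E[N(y)] = E[τ_+] U_+(y)`. -/
theorem IsIID.meanPassage_eq {P : Measure Ω} [IsProbabilityMeasure P] {D : ℕ → Ω → ℝ}
    (hD : IsIID P D) {r : ℝ} (hfin : ∀ y, meanPassage P D r y ≠ ∞) (y : ℝ) :
    meanPassage P D r y = meanLadderTime P D r * renewalMeasure P D r (Iic y) := by
  have he : meanLadderTime P D r ≠ ∞ := ne_top_of_le_ne_top (hfin 0) (meanLadderTime_le P D r)
  have hU : renewalMeasure P D r (Iic y) ≠ ∞ := by
    refine ne_top_of_le_ne_top (hfin y) (le_trans ?_ (hD.renewal_le he y))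
    exact le_mul_of_one_le_left zero_le (one_le_meanLadderTime P D r)
  refine le_antisymm ?_ (hD.renewal_le he y)
  -- The remainder is at most `m(y) G_+^{*n}((-∞, y])`, which tends to `0` as the general term of
  -- the convergent series for `U_+(y)`.
  have h0 := ENNReal.tendsto_atTop_zero_of_tsum_ne_top ((renewalMeasure_Iic P D r y) ▸ hU)
  have hlim : Tendsto (fun n => meanLadderTime P D r * renewalMeasure P D r (Iic y) +
      meanPassage P D r y * convPow (ladderLaw P D r) n (Iic y)) atTop
      (𝓝 (meanLadderTime P D r * renewalMeasure P D r (Iic y) + meanPassage P D r y * 0)) :=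
    tendsto_const_nhds.add (ENNReal.Tendsto.const_mul h0 (Or.inr (hfin y)))
  rw [mul_zero, add_zero] at hlim
  refine ge_of_tendsto' hlim fun n => ?_
  conv_lhs => rw [hD.meanPassage_iterate he y n]
  refine add_le_add ?_ ?_
  · rw [renewalMeasure_Iic]
    exact mul_le_mul_right (ENNReal.sum_le_tsum _) _
  · rw [← lintegral_indicator_const measurableSet_Iic]
    refine lintegral_mono_ae ?_
    filter_upwards [ae_nonneg_of_Iio_zero
      (convPow_Iio_zero (ladderLaw_Iio_zero P D hD.meas r) n)] with z hz
    by_cases h : z ≤ y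
    · rw [indicator_of_mem (by exact h)]
      exact meanPassage_mono P D r (by linarith)
    · rw [meanPassage_of_neg P D r (by linarith)]
      exact zero_le

/-- Wald's identity `μ_+ = E[τ_+] E[Y]`. -/
theorem IsIID.ladderMean_eq {P : Measure Ω} [IsProbabilityMeasure P] {D : ℕ → Ω → ℝ}
    (hD : IsIID P D) {r : ℝ} (hint : Integrable (D 0) P) (hfin : meanLadderTime P D r ≠ ∞) :
    ladderMean P D r = (meanLadderTime P D r).toReal * (∫ ω, D 0 ω ∂P - r) := by
  have hN := fun i => measurableSet_noLadder D hD.meas r i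
  have hintY : ∀ i, Integrable (fun ω => D i ω - r) P := fun i =>
    ((hD.ident i).integrable_iff.2 hint).sub (integrable_const r)
  have hY : ∀ i, ∫ ω, D i ω - r ∂P = ∫ ω, D 0 ω ∂P - r := by
    intro i
    rw [integral_sub ((hD.ident i).integrable_iff.2 hint) (integrable_const r),
      (hD.ident i).integral_eq]
    simp
  have hYabs : ∀ i, ∫ ω, ‖D i ω - r‖ ∂P = ∫ ω, ‖D 0 ω - r‖ ∂P := fun i =>
    ((hD.ident i).comp (u := fun z => ‖z - r‖) (by fun_prop)).integral_eq
  -- `τ_+ > i` is decided by the demands with index below `i`, hence is independent of `D i`.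
  have hindep : ∀ i, IndepFun ((noLadder D r i).indicator (1 : Ω → ℝ)) (fun ω => D i ω - r) P := by
    intro i
    have h := (hD.indepFun_shift i).comp
      (φ := (noLadder coord r i).indicator (1 : (ℕ → ℝ) → ℝ)) (ψ := fun b => b 0 - r)
      (measurable_one.indicator (measurableSet_noLadder _ measurable_coord r i)) (by fun_prop)
    convert h using 1
    swap
    · rfl
    funext ω
    refine indicator_eq_indicator (f := (1 : Ω → ℝ)) (g := (1 : (ℕ → ℝ) → ℝ)) ?_ rfl
    exact noLadder_congr (a := fun i => D i ω) fun j hj => by simp [hj]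
  -- `S_{τ_+} = ∑_i 1{τ_+ > i} Y_i`, integrated term by term; the sum of the norms is `E[τ_+] E|Y|`.
  set F : ℕ → Ω → ℝ := fun i ω => (noLadder D r i).indicator 1 ω * (D i ω - r)
  have hindm : ∀ i, AEStronglyMeasurable ((noLadder D r i).indicator (1 : Ω → ℝ)) P := fun i =>
    (measurable_one.indicator (hN i)).aestronglyMeasurable
  have hFint : ∀ i, Integrable (F i) P := by
    intro i
    have : F i = (noLadder D r i).indicator (fun ω => D i ω - r) := by
      funext ω
      by_cases h : ω ∈ noLadder D r i <;> simp [F, h]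
    rw [this]
    exact (hintY i).indicator (hN i)
  have hFnorm : ∀ i, ∫ ω, ‖F i ω‖ ∂P = P.real (noLadder D r i) * ∫ ω, ‖D 0 ω - r‖ ∂P := by
    intro i
    have h := ((hindep i).comp (φ := id) (ψ := fun z => ‖z‖) measurable_id
      measurable_norm).integral_fun_mul_eq_mul_integral (hindm i)
        (hintY i).aestronglyMeasurable.norm
    rw [← hYabs i, ← integral_indicator_one (hN i)]
    refine Eq.trans (integral_congr_ae (ae_of_all _ fun ω => ?_)) h
    by_cases hω : ω ∈ noLadder D r i <;> simp [F, hω]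
  have hFval : ∀ i, ∫ ω, F i ω ∂P = P.real (noLadder D r i) * (∫ ω, D 0 ω ∂P - r) := by
    intro i
    rw [← hY i, ← integral_indicator_one (hN i)]
    exact (hindep i).integral_fun_mul_eq_mul_integral (hindm i) (hintY i).aestronglyMeasurable
  have hsum : HasSum (fun i => P.real (noLadder D r i)) (meanLadderTime P D r).toReal := by
    have hne : ∀ i, P (noLadder D r i) ≠ ∞ := fun i => measure_ne_top _ _
    rw [meanLadderTime, ENNReal.tsum_toReal_eq hne]
    exact (ENNReal.summable_toReal hfin).hasSum
  have hW := hasSum_integral_of_summable_integral_norm (F := F) hFint (by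
    simp only [hFnorm]
    exact hsum.summable.mul_right _)
  simp only [hFval] at hW
  rw [← hW.unique (hsum.mul_right _), ladderMean, ladderLaw,
    Measure.restrict_eq_self_of_ae_mem (ae_ladderEvent hfin),
    integral_map (measurable_ladderHeight D hD.meas r).aemeasurable (by fun_prop)]
  refine integral_congr_ae ?_
  filter_upwards [ae_ladderEvent hfin] with ω hω
  rw [ladderEvent_eq_iUnion, mem_iUnion] at hω
  obtain ⟨k, hk⟩ := hω
  rw [ladderTime_of_firstLadder hk, tsum_eq_sum (s := Finset.range (k + 1)), walk]
  · refine Finset.sum_congr rfl fun i hi => ?_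
    have : ω ∈ noLadder D r i :=
      noLadder_anti D r (Nat.le_of_lt_succ (Finset.mem_range.1 hi)) hk.1
    simp [F, this]
  · intro i hi
    have : ω ∉ noLadder D r i := fun h => absurd
      (h (k + 1) (Nat.succ_pos k) (by simpa using hi)) (not_lt.2 hk.2)
    simp [F, this]

/-! ### The one-step equation of the total excess inventory -/

theorem meanGain_of_nonpos (P : Measure Ω) (D : ℕ → Ω → ℝ) (r : ℝ) {x : ℝ} (hx : x ≤ 0) :
    meanGain P D r x = 0 := by
  refine ENNReal.tsum_eq_zero.2 fun t => ?_
  refine (lintegral_congr fun ω => ?_).trans lintegral_zero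
  exact ENNReal.ofReal_of_nonpos (by linarith [runMax_nonneg D r t ω])

theorem lintegral_inventory {P : Measure Ω} {D : ℕ → Ω → ℝ} (hD : ∀ t, Measurable (D t)) (r : ℝ)
    {x : ℝ} (hx : 0 ≤ x) (t : ℕ) :
    ∫⁻ ω, ENNReal.ofReal (inventory D r x t ω) ∂P =
      ∫⁻ ω, ENNReal.ofReal (inventory D r 0 t ω) ∂P +
        ∫⁻ ω, ENNReal.ofReal (x - runMax D r t ω) ∂P := by
  rw [← lintegral_add_left (measurable_inventory D hD r 0 t).ennreal_ofReal]
  refine lintegral_congr fun ω => ?_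
  rw [inventory_eq_add hx, ENNReal.ofReal_add (inventory_nonneg le_rfl D r t ω) (le_max_right _ _)]
  simp

theorem IsIID.lintegral_inventory_succ {P : Measure Ω} [IsProbabilityMeasure P] {D : ℕ → Ω → ℝ}
    (hD : IsIID P D) (r x : ℝ) (t : ℕ) :
    ∫⁻ ω, ENNReal.ofReal (inventory D r x (t + 1) ω) ∂P =
      ∫⁻ ω, ∫⁻ ω', ENNReal.ofReal (inventory D r (max (x + r - D 0 ω) 0) t ω') ∂P ∂P := by
  have hmeas : ∀ t, Measurable fun q : ℝ × (ℕ → ℝ) => inventory coord r q.1 t q.2 := by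
    intro t
    induction t with
    | zero => exact measurable_fst
    | succ t ih => exact ((ih.add_const r).sub
        ((measurable_coord t).comp measurable_snd)).max measurable_const
  have h := hD.lintegral_split 1
    (f := fun a b => ENNReal.ofReal (inventory coord r (max (x + r - a 0) 0) t b))
    ((hmeas t).comp ((Measurable.max (by fun_prop) measurable_const).prodMk
      measurable_snd)).ennreal_ofReal
    (fun a a' b h => by simp only [h 0 one_pos])
  simp only [← inventory_eq] at h
  rw [← h]
  refine lintegral_congr fun ω => ?_
  rw [inventory_eq, inventory_succ_front, ← inventory_eq (fun i => D (1 + i))]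

/-- Conditioning on the first demand, and summing over all periods. -/
theorem IsIID.meanGain_step {P : Measure Ω} [IsProbabilityMeasure P] {D : ℕ → Ω → ℝ}
    (hD : IsIID P D) (r : ℝ) {x : ℝ} (hx : 0 ≤ x) :
    ∫⁻ ω, ⨆ t, ENNReal.ofReal (backInventory r t (fun i => D i ω)) ∂P + meanGain P D r x =
      ENNReal.ofReal x + ∫⁻ ω, meanGain P D r (x + r - D 0 ω) ∂P := by
  set F : ℕ → ℝ≥0∞ := fun t => ∫⁻ ω, ENNReal.ofReal (inventory D r 0 t ω) ∂P
  set g : ℕ → ℝ → ℝ≥0∞ := fun t z => ∫⁻ ω, ENNReal.ofReal (z - runMax D r t ω) ∂P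
  have hI : Measurable (fun ω i => D i ω) := measurable_pi_iff.2 fun i => hD.meas i
  have hg : ∀ t, Measurable (g t) := fun t => Monotone.measurable fun a b hab =>
    lintegral_mono fun ω => ENNReal.ofReal_le_ofReal (sub_le_sub_right hab _)
  -- The stock after one period is `(x - Y)^+`; the truncation can be dropped since `g t` vanishes
  -- on negative arguments.
  have hgmax : ∀ t z, g t (max z 0) = g t z := by
    intro t z
    rcases le_total 0 z with h | h
    · rw [max_eq_left h]
    · refine lintegral_congr fun ω => ?_
      have := runMax_nonneg D r t ω
      rw [max_eq_right h, ENNReal.ofReal_of_nonpos (by linarith),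
        ENNReal.ofReal_of_nonpos (by linarith)]
  have hY : Measurable fun ω => x + r - D 0 ω := measurable_const.sub (hD.meas 0)
  have hrec : ∀ t, F (t + 1) + g (t + 1) x = F t + ∫⁻ ω, g t (x + r - D 0 ω) ∂P := by
    intro t
    rw [← lintegral_inventory hD.meas r hx, hD.lintegral_inventory_succ]
    have : ∀ ω, ∫⁻ ω', ENNReal.ofReal (inventory D r (max (x + r - D 0 ω) 0) t ω') ∂P =
        F t + g t (x + r - D 0 ω) := fun ω => by
      rw [lintegral_inventory hD.meas r (le_max_right _ _) t, ← hgmax t]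
    simp only [this]
    rw [lintegral_add_left measurable_const, lintegral_const, measure_univ, mul_one]
  -- The sum of `hrec` over `t < n`, with `F` telescoped and `F 0 = 0`, written without subtraction
  -- as the values are in `[0, ∞]`.
  have hsum : ∀ n, F n + ∑ t ∈ Finset.range n, g (t + 1) x =
      ∑ t ∈ Finset.range n, ∫⁻ ω, g t (x + r - D 0 ω) ∂P := by
    intro n
    induction n with
    | zero => simp [F, inventory]
    | succ n ih =>
      rw [Finset.sum_range_succ, Finset.sum_range_succ, ← ih, add_comm (∑ t ∈ _, _) (g (n + 1) x),
        ← add_assoc, hrec]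
      ring
  have hF : Tendsto F atTop
      (𝓝 (∫⁻ ω, ⨆ t, ENNReal.ofReal (backInventory r t (fun i => D i ω)) ∂P)) := by
    have hFb : F = fun t => ∫⁻ ω, ENNReal.ofReal (backInventory r t (fun i => D i ω)) ∂P :=
      funext fun t => lintegral_backInventory hD r t ENNReal.measurable_ofReal
    have hmono : Monotone fun t ω => ENNReal.ofReal (backInventory r t (fun i => D i ω)) :=
      fun a b hab ω => ENNReal.ofReal_le_ofReal (backInventory_mono r _ hab)
    have hb : ∀ t, Measurable fun ω => ENNReal.ofReal (backInventory r t (fun i => D i ω)) :=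
      fun t => ((measurable_backInventory r t).comp hI).ennreal_ofReal
    rw [hFb, lintegral_iSup hb hmono]
    exact tendsto_atTop_iSup fun a b hab => lintegral_mono (hmono hab)
  have hlim := tendsto_nhds_unique
    ((hF.add (ENNReal.tendsto_nat_tsum fun t => g (t + 1) x)).congr hsum)
    (ENNReal.tendsto_nat_tsum fun t => ∫⁻ ω, g t (x + r - D 0 ω) ∂P)
  have hgY : ∀ t, Measurable fun ω => g t (x + r - D 0 ω) := fun t => (hg t).comp hY
  rw [← lintegral_tsum fun t => (hgY t).aemeasurable] at hlim
  -- The shifted sum misses the term `t = 0`, which is `x`.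
  have h0 : meanGain P D r x = ENNReal.ofReal x + ∑' t, g (t + 1) x := by
    have : g 0 x = ENNReal.ofReal x := by simp [g, runMax]
    rw [← this]
    exact tsum_eq_zero_add' ENNReal.summable
  rw [h0, add_left_comm, hlim]
  rfl

/-! ### The steady state -/

/-- The steady-state inventory level, as the limit of the inventory levels with the demands taken
in the reverse order. -/
noncomputable def steadyInventory (D : ℕ → Ω → ℝ) (r : ℝ) (ω : Ω) : ℝ :=
  ⨆ t, backInventory r t (fun i => D i ω)

theorem measurable_steadyInventory (D : ℕ → Ω → ℝ) (hD : ∀ t, Measurable (D t)) (r : ℝ) :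
    Measurable (steadyInventory D r) :=
  Measurable.iSup fun t => (measurable_backInventory r t).comp (measurable_pi_iff.2 hD)

theorem steadyInventory_nonneg {Ω : Type*} (D : ℕ → Ω → ℝ) (r : ℝ) (ω : Ω) :
    0 ≤ steadyInventory D r ω :=
  Real.iSup_nonneg fun t => backInventory_nonneg r t _

/-- Needed because a real supremum has a default value on unbounded sets; the extended one shows
that these occur with probability `0`. -/
theorem ae_bddAbove_backInventory {P : Measure Ω} {D : ℕ → Ω → ℝ} (hD : ∀ t, Measurable (D t))
    {r : ℝ} (h : ∫⁻ ω, ⨆ t, ENNReal.ofReal (backInventory r t (fun i => D i ω)) ∂P ≠ ∞) :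
    ∀ᵐ ω ∂P, BddAbove (range fun t => backInventory r t (fun i => D i ω)) := by
  have hm : Measurable fun ω => ⨆ t, ENNReal.ofReal (backInventory r t (fun i => D i ω)) :=
    Measurable.iSup fun t => ((measurable_backInventory r t).comp
      (measurable_pi_iff.2 hD)).ennreal_ofReal
  filter_upwards [ae_lt_top hm h] with ω hω
  refine ⟨(⨆ t, ENNReal.ofReal (backInventory r t (fun i => D i ω))).toReal, ?_⟩
  rintro _ ⟨t, rfl⟩
  rw [← ENNReal.ofReal_le_iff_le_toReal hω.ne]
  exact le_iSup (fun t => ENNReal.ofReal (backInventory r t (fun i => D i ω))) t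

theorem lintegral_steadyInventory {P : Measure Ω} {D : ℕ → Ω → ℝ} (hD : ∀ t, Measurable (D t))
    {r : ℝ} (h : ∫⁻ ω, ⨆ t, ENNReal.ofReal (backInventory r t (fun i => D i ω)) ∂P ≠ ∞) :
    ∫⁻ ω, ENNReal.ofReal (steadyInventory D r ω) ∂P =
      ∫⁻ ω, ⨆ t, ENNReal.ofReal (backInventory r t (fun i => D i ω)) ∂P := by
  refine lintegral_congr_ae ?_
  filter_upwards [ae_bddAbove_backInventory hD h] with ω hω
  refine tendsto_nhds_unique (ENNReal.tendsto_ofReal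
    (tendsto_atTop_ciSup (backInventory_mono r _) hω)) (tendsto_atTop_iSup fun a b hab => ?_)
  exact ENNReal.ofReal_le_ofReal (backInventory_mono r _ hab)

/-- The reversed levels increase to their supremum, so the events `· ≤ y` decrease to that of the
limit. Continuity from above gives convergence at every `y`, not only at continuity points. -/
theorem IsIID.isSteadyState {P : Measure Ω} [IsProbabilityMeasure P] {D : ℕ → Ω → ℝ}
    (hD : IsIID P D) {r : ℝ}
    (h : ∫⁻ ω, ⨆ t, ENNReal.ofReal (backInventory r t (fun i => D i ω)) ∂P ≠ ∞) :
    IsSteadyState P D r (P.map (steadyInventory D r)) := by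
  have hZ := measurable_steadyInventory D hD.meas r
  have hb : ∀ t, Measurable fun ω => backInventory r t (fun i => D i ω) := fun t =>
    (measurable_backInventory r t).comp (measurable_pi_iff.2 hD.meas)
  refine ⟨Measure.isProbabilityMeasure_map hZ.aemeasurable, fun y => ?_⟩
  have heq : ∀ t, P {ω | inventory D r 0 t ω ≤ y} =
      P {ω | backInventory r t (fun i => D i ω) ≤ y} := by
    intro t
    have := lintegral_backInventory hD r t
      ((measurable_one (α := ℝ≥0∞)).indicator (measurableSet_Iic (a := y)))
    rw [← lintegral_indicator_one (measurableSet_le (measurable_inventory D hD.meas r 0 t)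
      measurable_const), ← lintegral_indicator_one (measurableSet_le (hb t) measurable_const)]
    exact this
  have hanti : Antitone fun t => {ω | backInventory r t (fun i => D i ω) ≤ y} :=
    fun a b hab ω hω => (backInventory_mono r _ hab).trans hω
  have hlim := tendsto_measure_iInter_atTop (μ := P)
    (fun t => (measurableSet_le (hb t) (measurable_const (a := y))).nullMeasurableSet)
    hanti ⟨0, measure_ne_top _ _⟩
  have hinter : P (⋂ t, {ω | backInventory r t (fun i => D i ω) ≤ y}) =
      P.map (steadyInventory D r) (Iic y) := by
    rw [Measure.map_apply hZ measurableSet_Iic]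
    refine measure_congr ?_
    filter_upwards [ae_bddAbove_backInventory hD.meas h] with ω hω
    refine propext ?_
    change ω ∈ (⋂ t, {ω | backInventory r t (fun i => D i ω) ≤ y}) ↔
      steadyInventory D r ω ≤ y
    rw [mem_iInter, steadyInventory, ciSup_le_iff hω]
    rfl
  rw [hinter] at hlim
  simp only [Measure.real, heq]
  have := Measure.isProbabilityMeasure_map (μ := P) hZ.aemeasurable
  exact (ENNReal.tendsto_toReal (measure_ne_top _ _)).comp hlim

/-! ### Cost differences -/

theorem integrable_inventory {P : Measure Ω} [IsFiniteMeasure P] {D : ℕ → Ω → ℝ}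
    (hD : ∀ t, Integrable (D t) P) (r x : ℝ) (t : ℕ) : Integrable (inventory D r x t) P := by
  induction t with
  | zero => exact integrable_const x
  | succ t ih => exact ((ih.add (integrable_const r)).sub (hD t)).pos_part

theorem integrable_periodCost {P : Measure Ω} [IsFiniteMeasure P] {D : ℕ → Ω → ℝ}
    (hD : ∀ t, Integrable (D t) P) (h p r x : ℝ) (t : ℕ) :
    Integrable (periodCost D h p r x t) P :=
  ((((integrable_inventory hD r x t).add (integrable_const r)).sub (hD t)).pos_part.const_mul h).add
    ((((hD t).sub (integrable_inventory hD r x t)).sub (integrable_const r)).pos_part.const_mul p)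

/-- The lost sales of a period are `J_{t+1} - J_t + Y_t`, so their sum telescopes. -/
theorem sum_periodCost {Ω : Type*} (D : ℕ → Ω → ℝ) (h p r x : ℝ) (n : ℕ) (ω : Ω) :
    ∑ t ∈ Finset.range n, periodCost D h p r x t ω =
      h * ∑ t ∈ Finset.range n, inventory D r x (t + 1) ω +
        p * (inventory D r x n ω - x + walk D r n ω) := by
  induction n with
  | zero => simp [inventory, walk_zero]
  | succ n ih =>
    rw [Finset.sum_range_succ, Finset.sum_range_succ, ih, walk_succ, periodCost]
    have h1 : inventory D r x (n + 1) ω = max (inventory D r x n ω + r - D n ω) 0 := rfl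
    have h2 : max (D n ω - inventory D r x n ω - r) 0 =
        max (inventory D r x n ω + r - D n ω) 0 - (inventory D r x n ω + r - D n ω) := by
      rcases le_total (inventory D r x n ω + r - D n ω) 0 with h | h
      · rw [max_eq_right h, max_eq_left (by linarith)]; ring
      · rw [max_eq_left h, max_eq_right (by linarith)]; ring
    rw [h1, h2]
    ring

theorem integrable_gain {P : Measure Ω} [IsFiniteMeasure P] {D : ℕ → Ω → ℝ}
    (hD : ∀ t, Measurable (D t)) (r x : ℝ) (t : ℕ) :
    Integrable (fun ω => max (x - runMax D r t ω) 0) P := by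
  refine Integrable.of_bound (C := |x|) ((measurable_const.sub
    (measurable_runMax D hD r t)).max measurable_const).aestronglyMeasurable
    (ae_of_all _ fun ω => ?_)
  rw [Real.norm_eq_abs, abs_of_nonneg (le_max_right _ _)]
  exact max_le (by linarith [runMax_nonneg D r t ω, le_abs_self x]) (abs_nonneg x)

theorem hasSum_gain {P : Measure Ω} [IsFiniteMeasure P] {D : ℕ → Ω → ℝ}
    (hD : ∀ t, Measurable (D t)) {r x : ℝ} (h : meanGain P D r x ≠ ∞) :
    HasSum (fun t => ∫ ω, max (x - runMax D r t ω) 0 ∂P) (meanGain P D r x).toReal := by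
  have hne := ENNReal.ne_top_of_tsum_ne_top h
  have heq : ∀ t, ∫ ω, max (x - runMax D r t ω) 0 ∂P =
      (∫⁻ ω, ENNReal.ofReal (x - runMax D r t ω) ∂P).toReal := by
    intro t
    have hnn : ∀ ω, 0 ≤ max (x - runMax D r t ω) 0 := fun ω => le_max_right _ _
    rw [integral_eq_lintegral_of_nonneg_ae (ae_of_all _ hnn) (integrable_gain hD r x t).1]
    simp
  simp only [heq]
  rw [meanGain, ENNReal.tsum_toReal_eq hne]
  exact (ENNReal.summable_toReal h).hasSum

theorem integral_cost_sub {P : Measure Ω} [IsProbabilityMeasure P] {D : ℕ → Ω → ℝ}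
    (hm : ∀ t, Measurable (D t)) (hD : ∀ t, Integrable (D t) P) (h p r : ℝ) {x₁ x₂ : ℝ}
    (h₁ : 0 ≤ x₁) (h₂ : 0 ≤ x₂) (n : ℕ) :
    (∫ ω, ∑ t ∈ Finset.range n, periodCost D h p r x₁ t ω ∂P)
        - ∫ ω, ∑ t ∈ Finset.range n, periodCost D h p r x₂ t ω ∂P =
      h * (∑ t ∈ Finset.range n, ∫ ω, max (x₁ - runMax D r (t + 1) ω) 0 ∂P
        - ∑ t ∈ Finset.range n, ∫ ω, max (x₂ - runMax D r (t + 1) ω) 0 ∂P)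
        + p * (∫ ω, max (x₁ - runMax D r n ω) 0 ∂P - ∫ ω, max (x₂ - runMax D r n ω) 0 ∂P
          - x₁ + x₂) := by
  have hc : ∀ x, Integrable (fun ω => ∑ t ∈ Finset.range n, periodCost D h p r x t ω) P :=
    fun x => integrable_finsetSum _ fun t _ => integrable_periodCost hD h p r x t
  have hg := fun x t => integrable_gain (P := P) hm r x t
  rw [← integral_sub (hc x₁) (hc x₂), ← integral_finsetSum _ fun t _ => hg x₁ (t + 1),
    ← integral_finsetSum _ fun t _ => hg x₂ (t + 1)]
  have hs : ∀ x, Integrable (fun ω => ∑ t ∈ Finset.range n, max (x - runMax D r (t + 1) ω) 0) P :=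
    fun x => integrable_finsetSum _ fun t _ => hg x (t + 1)
  rw [← integral_sub (hs x₁) (hs x₂), ← integral_sub (hg x₁ n) (hg x₂ n)]
  have hconst : ∀ f : Ω → ℝ, Integrable f P → ∫ ω, f ω ∂P - x₁ + x₂ = ∫ ω, f ω - x₁ + x₂ ∂P := by
    intro f hf
    have hf' : Integrable (fun ω => f ω - x₁) P := hf.sub (integrable_const _)
    rw [integral_add hf' (integrable_const _), integral_sub hf (integrable_const _)]
    simp
  have hd : Integrable (fun ω => max (x₁ - runMax D r n ω) 0 - max (x₂ - runMax D r n ω) 0) P :=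
    (hg x₁ n).sub (hg x₂ n)
  have hA : Integrable (fun ω => h * (∑ t ∈ Finset.range n, max (x₁ - runMax D r (t + 1) ω) 0 -
      ∑ t ∈ Finset.range n, max (x₂ - runMax D r (t + 1) ω) 0)) P :=
    ((hs x₁).sub (hs x₂)).const_mul h
  have hB : Integrable (fun ω => p * (max (x₁ - runMax D r n ω) 0 - max (x₂ - runMax D r n ω) 0 -
      x₁ + x₂)) P :=
    ((hd.sub (integrable_const x₁)).add (integrable_const x₂)).const_mul p
  rw [hconst _ hd, ← integral_const_mul, ← integral_const_mul, ← integral_add hA hB]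
  refine integral_congr_ae (ae_of_all _ fun ω => ?_)
  simp only [sum_periodCost, inventory_eq_add h₁, inventory_eq_add h₂, Finset.sum_add_distrib]
  ring

/-- The inventory sums start at period `1` and so miss the term `x`; the excess at the horizon
vanishes as the general term of a convergent series, leaving `-p x` from the lost sales. -/
theorem tendsto_integral_cost_sub {P : Measure Ω} [IsProbabilityMeasure P] {D : ℕ → Ω → ℝ}
    (hm : ∀ t, Measurable (D t)) (hD : ∀ t, Integrable (D t) P) (h p : ℝ) {r : ℝ}
    (hfin : ∀ x, meanGain P D r x ≠ ∞) {x₁ x₂ : ℝ} (h₁ : 0 ≤ x₁) (h₂ : 0 ≤ x₂) :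
    Tendsto (fun n : ℕ => (∫ ω, ∑ t ∈ Finset.range n, periodCost D h p r x₁ t ω ∂P)
        - ∫ ω, ∑ t ∈ Finset.range n, periodCost D h p r x₂ t ω ∂P) atTop
      (𝓝 ((h * (meanGain P D r x₁).toReal - (h + p) * x₁) -
        (h * (meanGain P D r x₂).toReal - (h + p) * x₂))) := by
  have hsum : ∀ x, 0 ≤ x → Tendsto
      (fun n => ∑ t ∈ Finset.range n, ∫ ω, max (x - runMax D r (t + 1) ω) 0 ∂P) atTop
      (𝓝 ((meanGain P D r x).toReal - x)) := by
    intro x hx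
    have h0 := (hasSum_nat_add_iff' 1).2 (hasSum_gain hm (hfin x))
    convert h0.tendsto_sum_nat using 2
    simp [runMax, hx]
  have hz : ∀ x, Tendsto (fun n => ∫ ω, max (x - runMax D r n ω) 0 ∂P) atTop (𝓝 0) :=
    fun x => (hasSum_gain hm (hfin x)).summable.tendsto_atTop_zero
  simp only [integral_cost_sub hm hD h p r h₁ h₂]
  convert (((hsum x₁ h₁).sub (hsum x₂ h₂)).const_mul h).add
    (((((hz x₁).sub (hz x₂)).sub_const x₁).add_const x₂).const_mul p) using 2
  ring

/-! ### Uniqueness -/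

/-- Uniqueness of the solution of moderate growth of the Wiener–Hopf equation. -/
theorem IsWienerHopfSolution.unique {a : ℝ → ℝ} {F : Measure ℝ} {v₁ v₂ : ℝ → ℝ}
    (hF : ∀ ε : ℝ, 0 < ε → Integrable (fun y => Real.exp (-ε * y)) F)
    (h₁ : IsWienerHopfSolution a F v₁) (h₂ : IsWienerHopfSolution a F v₂)
    (g₁ : HasModerateGrowth F v₁) (g₂ : HasModerateGrowth F v₂) {x : ℝ} (hx : 0 ≤ x) :
    v₁ x = v₂ x := by
  obtain ⟨ε₁, C₁, hε₁, hφ₁, hC₁⟩ := g₁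
  obtain ⟨ε₂, C₂, hε₂, hφ₂, hC₂⟩ := g₂
  have hnn : ∀ (C ε : ℝ) (v : ℝ → ℝ), (∀ x, 0 ≤ x → |v x| ≤ C * Real.exp (ε * x)) → 0 ≤ C := by
    intro C ε v H
    simpa using (abs_nonneg _).trans (H 0 le_rfl)
  have hC₁0 := hnn _ _ _ hC₁
  have hC₂0 := hnn _ _ _ hC₂
  -- The larger exponent dominates both growth bounds and still has `φ < 1`.
  obtain ⟨ε, hε, hφ, h1ε, h2ε⟩ : ∃ ε : ℝ, 0 < ε ∧ ∫ y, Real.exp (-ε * y) ∂F < 1 ∧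
      ε₁ ≤ ε ∧ ε₂ ≤ ε := by
    rcases le_total ε₁ ε₂ with h | h
    · exact ⟨ε₂, hε₂, hφ₂, h, le_rfl⟩
    · exact ⟨ε₁, hε₁, hφ₁, le_rfl, h⟩
  set φ := ∫ y, Real.exp (-ε * y) ∂F
  have hφ0 : 0 ≤ φ := integral_nonneg fun y => (Real.exp_pos _).le
  -- The inhomogeneous terms cancel in the difference, and each use of the equation gains a factor
  -- `φ`.
  have hbound : ∀ n : ℕ, ∀ z, 0 ≤ z →
      |v₁ z - v₂ z| ≤ (C₁ + C₂) * φ ^ n * Real.exp (ε * z) := by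
    intro n
    induction n with
    | zero =>
      intro z hz
      have e1 : Real.exp (ε₁ * z) ≤ Real.exp (ε * z) :=
        Real.exp_le_exp.2 (mul_le_mul_of_nonneg_right h1ε hz)
      have e2 : Real.exp (ε₂ * z) ≤ Real.exp (ε * z) :=
        Real.exp_le_exp.2 (mul_le_mul_of_nonneg_right h2ε hz)
      calc |v₁ z - v₂ z| ≤ |v₁ z| + |v₂ z| := abs_sub _ _
        _ ≤ C₁ * Real.exp (ε * z) + C₂ * Real.exp (ε * z) :=
          add_le_add ((hC₁ z hz).trans (mul_le_mul_of_nonneg_left e1 hC₁0))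
            ((hC₂ z hz).trans (mul_le_mul_of_nonneg_left e2 hC₂0))
        _ = _ := by ring
    | succ n ih =>
      intro z hz
      have hint : Integrable
          (fun y => (C₁ + C₂) * φ ^ n * Real.exp (ε * z) * Real.exp (-ε * y)) F :=
        (hF ε hε).const_mul _
      rw [h₁.eqn z hz, h₂.eqn z hz, add_sub_add_left_eq_sub,
        ← integral_sub (h₁.integrable z hz) (h₂.integrable z hz)]
      calc |∫ y in Iic z, v₁ (z - y) - v₂ (z - y) ∂F|
          ≤ ∫ y in Iic z, (C₁ + C₂) * φ ^ n * Real.exp (ε * z) * Real.exp (-ε * y) ∂F := by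
            rw [← Real.norm_eq_abs]
            refine norm_integral_le_of_norm_le hint.integrableOn ?_
            filter_upwards [ae_restrict_mem measurableSet_Iic] with y hy
            rw [Real.norm_eq_abs, mul_assoc, ← Real.exp_add]
            have := ih (z - y) (sub_nonneg.2 hy)
            rwa [show ε * z + -ε * y = ε * (z - y) by ring]
        _ ≤ ∫ y, (C₁ + C₂) * φ ^ n * Real.exp (ε * z) * Real.exp (-ε * y) ∂F :=
            setIntegral_le_integral hint (ae_of_all _ fun y => by
              have := Real.exp_pos
              positivity)
        _ = _ := by
            rw [integral_const_mul]
            ring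
  have hlim : Tendsto (fun n : ℕ => (C₁ + C₂) * φ ^ n * Real.exp (ε * x)) atTop (𝓝 0) := by
    simpa using ((tendsto_pow_atTop_nhds_zero_of_lt_one hφ0 hφ).const_mul
      (C₁ + C₂)).mul_const (Real.exp (ε * x))
  have h0 : |v₁ x - v₂ x| ≤ 0 := ge_of_tendsto' hlim fun n => hbound n x hx
  exact sub_eq_zero.1 (abs_nonpos_iff.1 h0)

/-! ### The explicit value function -/

/-- The explicit value function in terms of the total mean excess inventory. -/
theorem IsIID.explicitValue_eq {P : Measure Ω} [IsProbabilityMeasure P] {D : ℕ → Ω → ℝ}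
    (hD : IsIID P D) (h p : ℝ) {r : ℝ} (hint : Integrable (D 0) P) (hr : r < ∫ ω, D 0 ω ∂P)
    (hfin : ∀ y, meanPassage P D r y ≠ ∞) {x : ℝ} (hx : 0 ≤ x) :
    explicitValue P D h p r x = h * (meanGain P D r x).toReal - (h + p) * x := by
  have he : meanLadderTime P D r ≠ ∞ := ne_top_of_le_ne_top (hfin 0) (meanLadderTime_le P D r)
  have hm : ∫ ω, D 0 ω ∂P - r ≠ 0 := (sub_pos.2 hr).ne'
  have hmono : Monotone fun y => renewalMeasure P D r (Iic y) := fun a b hab =>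
    measure_mono (Iic_subset_Iic.2 hab)
  have hgain : meanGain P D r x =
      meanLadderTime P D r * ∫⁻ y in Icc 0 x, renewalMeasure P D r (Iic y) := by
    rw [hD.meanGain_eq, ← lintegral_const_mul _ hmono.measurable]
    exact lintegral_congr fun y => hD.meanPassage_eq hfin y
  have hU : ∀ y, renewalMeasure P D r (Iic y) ≠ ∞ := fun y =>
    ne_top_of_le_ne_top (hfin y) ((le_mul_of_one_le_left zero_le
      (one_le_meanLadderTime P D r)).trans (hD.renewal_le he y))
  have hV : ∫ y in (0 : ℝ)..x, (renewalMeasure P D r).real (Iic y) =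
      (∫⁻ y in Icc 0 x, renewalMeasure P D r (Iic y)).toReal := by
    rw [intervalIntegral.integral_of_le hx, ← integral_Icc_eq_integral_Ioc]
    exact integral_toReal hmono.measurable.aemeasurable (ae_of_all _ fun y => (hU y).lt_top)
  rw [explicitValue, hD.ladderMean_eq hint he, hV, hgain, ENNReal.toReal_mul]
  field_simp

/-- The explicit value function solves the Wiener–Hopf equation. -/
theorem IsIID.isWienerHopfSolution {P : Measure Ω} [IsProbabilityMeasure P] {D : ℕ → Ω → ℝ}
    (hD : IsIID P D) (h0 : ∀ᵐ ω ∂P, 0 ≤ D 0 ω) (h p : ℝ) {r : ℝ} (hint : Integrable (D 0) P)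
    (hfin : ∀ x, meanGain P D r x ≠ ∞) {ν : Measure ℝ}
    (hL : ∫⁻ ω, ⨆ t, ENNReal.ofReal (backInventory r t (fun i => D i ω)) ∂P ≠ ∞)
    (hν : ∫ z, z ∂ν =
      (∫⁻ ω, ⨆ t, ENNReal.ofReal (backInventory r t (fun i => D i ω)) ∂P).toReal)
    {v : ℝ → ℝ} (hv : ∀ x, 0 ≤ x → v x = h * (meanGain P D r x).toReal - (h + p) * x) :
    IsWienerHopfSolution (inhomogeneity h p (excessLaw P D r) ν) (excessLaw P D r) v := by
  have hY : Measurable fun ω => D 0 ω - r := (hD.meas 0).sub_const r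
  have hprob : IsProbabilityMeasure (excessLaw P D r) :=
    excessLaw_isProbabilityMeasure (hD.meas 0) r
  set F := excessLaw P D r with hF
  have hid : Integrable (fun y => y) F := by
    rw [hF, excessLaw, integrable_map_measure (by fun_prop) hY.aemeasurable]
    exact hint.sub (integrable_const r)
  have hgm : Measurable (meanGain P D r) := (meanGain_mono P D r).measurable
  have hgmx : ∀ x, Measurable fun y => meanGain P D r (x - y) := fun x =>
    hgm.comp (measurable_const.sub measurable_id)
  -- Since `Y ≥ -r` almost surely, monotonicity bounds the integrand by its value at `x + r`.
  have hgi : ∀ x, Integrable (fun y => (meanGain P D r (x - y)).toReal) F := by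
    intro x
    refine Integrable.of_bound (C := (meanGain P D r (x + r)).toReal)
      (hgmx x).ennreal_toReal.aestronglyMeasurable ?_
    filter_upwards [ae_excessLaw (hD.meas 0) h0 r] with y hy
    rw [Real.norm_eq_abs, abs_of_nonneg ENNReal.toReal_nonneg]
    exact ENNReal.toReal_mono (hfin _) (meanGain_mono P D r (by linarith))
  have hpi : ∀ x, Integrable (fun y => max (x - y) 0) F := fun x =>
    ((integrable_const x).sub hid).pos_part
  have hui : ∀ x, Integrable
      (fun y => h * (meanGain P D r (x - y)).toReal - (h + p) * max (x - y) 0) F := fun x =>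
    ((hgi x).const_mul h).sub ((hpi x).const_mul (h + p))
  -- `v` is prescribed on `[0, ∞)` only. The replacement agrees with it for `y ≤ x` and vanishes for
  -- `y > x`, so the integral may be taken over the whole line.
  have hvu : ∀ x, EqOn (fun y => v (x - y))
      (fun y => h * (meanGain P D r (x - y)).toReal - (h + p) * max (x - y) 0) (Iic x) := by
    intro x y hy
    have hxy : 0 ≤ x - y := sub_nonneg.2 hy
    simp only [hv _ hxy, max_eq_left hxy]
  refine ⟨?_, fun x _ => ?_, fun x hx => ?_⟩
  · rw [hv 0 le_rfl, meanGain_of_nonpos P D r le_rfl]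
    simp
  · exact (hui x).integrableOn.congr_fun (hvu x).symm measurableSet_Iic
  · have hstep := congrArg ENNReal.toReal (hD.meanGain_step r hx)
    have hgY : ∫⁻ ω, meanGain P D r (x + r - D 0 ω) ∂P = ∫⁻ y, meanGain P D r (x - y) ∂F := by
      rw [hF, excessLaw, lintegral_map (hgmx x) hY]
      simp only [sub_sub_eq_add_sub]
    have hgtop : ∫⁻ y, meanGain P D r (x - y) ∂F ≠ ∞ := by
      rw [← hgY]
      intro htop
      have := hD.meanGain_step r hx
      rw [htop, add_top] at this
      exact ENNReal.add_ne_top.2 ⟨hL, hfin x⟩ this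
    rw [hgY, ENNReal.toReal_add hL (hfin x), ENNReal.toReal_add ENNReal.ofReal_ne_top hgtop,
      ENNReal.toReal_ofReal hx, ← integral_toReal (hgmx x).aemeasurable
        (ae_of_all _ fun y => (hfin _).lt_top), ← hν] at hstep
    rw [hv x hx, setIntegral_congr_fun measurableSet_Iic (hvu x),
      setIntegral_eq_integral_of_forall_compl_eq_zero, integral_sub ((hgi x).const_mul h)
        ((hpi x).const_mul (h + p)), integral_const_mul, integral_const_mul, inhomogeneity]
    · have hneg : ∫ y, max (y - x) 0 ∂F = ∫ y, max (x - y) 0 ∂F + (∫ y, y ∂F - x) := by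
        have hyx : Integrable (fun y => y - x) F := hid.sub (integrable_const x)
        have hsub : ∫ y, y ∂F - x = ∫ y, y - x ∂F := by
          rw [integral_sub hid (integrable_const x)]
          simp
        rw [hsub, ← integral_add (hpi x) hyx]
        refine integral_congr_ae (ae_of_all _ fun y => ?_)
        rcases le_total x y with hxy | hxy
        · simp only [max_eq_left (sub_nonneg.2 hxy), max_eq_right (sub_nonpos.2 hxy), zero_add]
        · simp only [max_eq_right (sub_nonpos.2 hxy), max_eq_left (sub_nonneg.2 hxy)]
          ring
      rw [hneg]
      linear_combination h * hstep
    · intro y hy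
      have hxy : x - y ≤ 0 := by
        have : x < y := notMem_Iic.1 hy
        linarith
      rw [meanGain_of_nonpos P D r hxy, max_eq_right hxy]
      simp

theorem IsIID.hasModerateGrowth {P : Measure Ω} [IsProbabilityMeasure P] {D : ℕ → Ω → ℝ}
    (hD : IsIID P D) {h p r ε : ℝ} (hh : 0 ≤ h) (hp : 0 ≤ p) (hε : 0 < ε)
    (hφ : ∫ y, Real.exp (-ε * y) ∂(excessLaw P D r) < 1)
    (hφ' : ∫⁻ y, ENNReal.ofReal (Real.exp (-ε * y)) ∂(excessLaw P D r) < 1)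
    {v : ℝ → ℝ} (hv : ∀ x, 0 ≤ x → v x = h * (meanGain P D r x).toReal - (h + p) * x) :
    HasModerateGrowth (excessLaw P D r) v := by
  set K : ℝ≥0∞ := (1 - ∫⁻ y, ENNReal.ofReal (Real.exp (-ε * y)) ∂(excessLaw P D r))⁻¹ with hK
  have hKtop : K ≠ ∞ := ENNReal.inv_ne_top.2 (tsub_pos_of_lt hφ').ne'
  refine ⟨ε, h * (ε⁻¹ * K.toReal) + (h + p) * ε⁻¹, hε, hφ, fun x hx => ?_⟩
  have h1 : (meanGain P D r x).toReal ≤ ε⁻¹ * (Real.exp (ε * x) * K.toReal) := by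
    have := ENNReal.toReal_mono (ENNReal.mul_ne_top ENNReal.ofReal_ne_top
      (ENNReal.mul_ne_top ENNReal.ofReal_ne_top hKtop)) (hD.meanGain_le r hε x)
    rwa [ENNReal.toReal_mul, ENNReal.toReal_mul, ENNReal.toReal_ofReal (by positivity),
      ENNReal.toReal_ofReal (Real.exp_pos _).le] at this
  have h2 : x ≤ ε⁻¹ * Real.exp (ε * x) := by
    rw [inv_mul_eq_div, le_div_iff₀ hε]
    linarith [Real.add_one_le_exp (ε * x)]
  have h3 : 0 ≤ h * (meanGain P D r x).toReal := mul_nonneg hh ENNReal.toReal_nonneg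
  have h4 : 0 ≤ (h + p) * x := mul_nonneg (add_nonneg hh hp) hx
  have h5 := mul_le_mul_of_nonneg_left h1 hh
  have h6 := mul_le_mul_of_nonneg_left h2 (add_nonneg hh hp)
  rw [hv x hx, abs_le]
  constructor <;> nlinarith

end LostSales

/-! ### The main theorem -/

open LostSales in
theorem theorem1 {Ω : Type*} [MeasurableSpace Ω] (P : Measure Ω) [IsProbabilityMeasure P]
    (D : ℕ → Ω → ℝ)
    (hD_meas : ∀ t, Measurable (D t))
    (hD_indep : iIndepFun D P)
    (hD_ident : ∀ t, IdentDistrib (D t) (D 0) P P)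
    (hD_nonneg : ∀ᵐ ω ∂P, 0 ≤ D 0 ω)
    (hD_sq : MemLp (D 0) 2 P)
    (hD_var : 0 < variance (D 0) P)
    (h p r : ℝ) (hh : 0 ≤ h) (hp : 0 ≤ p)
    (hr0 : 0 ≤ r) (hr : r < ∫ ω, D 0 ω ∂P) :
    -- the ladder height is almost surely defined, its mean is finite, and so is `U_+`
    (∀ᵐ ω ∂P, ω ∈ LostSales.ladderEvent D r) ∧
    Integrable (fun z : ℝ => z) (LostSales.ladderLaw P D r) ∧
    (∀ y : ℝ, LostSales.renewalMeasure P D r (Iic y) < ⊤) ∧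
    -- the law `ν` of the steady-state inventory level exists and has a finite mean
    (∃ ν : Measure ℝ, LostSales.IsSteadyState P D r ν ∧ Integrable (fun z : ℝ => z) ν ∧
      -- the explicit function solves the Wiener–Hopf equation
      LostSales.IsWienerHopfSolution
        (LostSales.inhomogeneity h p (LostSales.excessLaw P D r) ν)
        (LostSales.excessLaw P D r) (LostSales.explicitValue P D h p r) ∧
      -- it is the only solution of moderate growth
      LostSales.HasModerateGrowth (LostSales.excessLaw P D r)
        (LostSales.explicitValue P D h p r) ∧
      ∀ v : ℝ → ℝ,
        LostSales.IsWienerHopfSolution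
          (LostSales.inhomogeneity h p (LostSales.excessLaw P D r) ν)
          (LostSales.excessLaw P D r) v →
        LostSales.HasModerateGrowth (LostSales.excessLaw P D r) v →
        ∀ x : ℝ, 0 ≤ x → v x = LostSales.explicitValue P D h p r x) ∧
    -- its differences are the differences of long-run total expected cost
    (∀ x₁ x₂ : ℝ, 0 ≤ x₁ → 0 ≤ x₂ →
      Tendsto
        (fun T : ℕ =>
          (∫ ω, ∑ t ∈ Finset.range T, LostSales.periodCost D h p r x₁ t ω ∂P)
            - ∫ ω, ∑ t ∈ Finset.range T, LostSales.periodCost D h p r x₂ t ω ∂P)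
        atTop
        (𝓝 (LostSales.explicitValue P D h p r x₁ - LostSales.explicitValue P D h p r x₂))) := by
  have hD : IsIID P D := ⟨hD_meas, hD_indep, hD_ident⟩
  have hint : Integrable (D 0) P := hD_sq.integrable one_le_two
  have hintt : ∀ t, Integrable (D t) P := fun t => (hD_ident t).integrable_iff.2 hint
  have hY : Measurable fun ω => D 0 ω - r := (hD_meas 0).sub_const r
  have hYsq : MemLp (fun ω => D 0 ω - r) 2 P := hD_sq.sub (memLp_const r)
  have hF : IsProbabilityMeasure (excessLaw P D r) := excessLaw_isProbabilityMeasure (hD_meas 0) r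
  have hexp : ∀ ε : ℝ, 0 < ε → Integrable (fun y => Real.exp (-ε * y)) (excessLaw P D r) :=
    fun ε hε => integrable_exp_excessLaw (hD_meas 0) hD_nonneg r hε
  obtain ⟨ε, hε, hφ⟩ := exists_integral_exp_lt_one (F := excessLaw P D r) hr0
    (ae_excessLaw (hD_meas 0) hD_nonneg r)
    (by
      rw [excessLaw, integrable_map_measure (by fun_prop) hY.aemeasurable]
      exact hYsq.integrable one_le_two)
    (by
      rw [excessLaw, integrable_map_measure (by fun_prop) hY.aemeasurable]
      exact hYsq.integrable_sq)
    (by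
      rw [excessLaw, integral_map hY.aemeasurable (by fun_prop),
        integral_sub hint (integrable_const r)]
      simpa using hr)
  have hφ' := lintegral_exp_lt_one (hexp ε hε) hφ
  have hK : (1 - ∫⁻ y, ENNReal.ofReal (Real.exp (-ε * y)) ∂(excessLaw P D r))⁻¹ ≠ ⊤ :=
    ENNReal.inv_ne_top.2 (tsub_pos_of_lt hφ').ne'
  have hpass : ∀ y, meanPassage P D r y ≠ ⊤ := fun y =>
    ne_top_of_le_ne_top (ENNReal.mul_ne_top ENNReal.ofReal_ne_top hK) (hD.meanPassage_le r hε y)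
  have hgain : ∀ x, meanGain P D r x ≠ ⊤ := fun x =>
    ne_top_of_le_ne_top (ENNReal.mul_ne_top ENNReal.ofReal_ne_top
      (ENNReal.mul_ne_top ENNReal.ofReal_ne_top hK)) (hD.meanGain_le r hε x)
  have he : meanLadderTime P D r ≠ ⊤ := ne_top_of_le_ne_top (hpass 0) (meanLadderTime_le P D r)
  have hv := fun x (hx : 0 ≤ x) => hD.explicitValue_eq h p hint hr hpass hx
  -- The one-step equation at `x = 0` bounds `E[J_∞]` by `E[g(-Y)] ≤ g(r)`, since demands are
  -- nonnegative.
  have hL : ∫⁻ ω, ⨆ t, ENNReal.ofReal (backInventory r t (fun i => D i ω)) ∂P ≠ ⊤ := by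
    refine ne_top_of_le_ne_top (ENNReal.add_ne_top.2 ⟨ENNReal.ofReal_ne_top, hgain r⟩)
      (le_self_add.trans ((hD.meanGain_step r (le_refl (0 : ℝ))).trans_le
        (add_le_add_right (b := ∫⁻ ω, meanGain P D r (0 + r - D 0 ω) ∂P) ?_ _)))
    calc ∫⁻ ω, meanGain P D r (0 + r - D 0 ω) ∂P ≤ ∫⁻ _, meanGain P D r r ∂P := by
          refine lintegral_mono_ae ?_
          filter_upwards [hD_nonneg] with ω hω
          exact meanGain_mono P D r (by linarith)
      _ = meanGain P D r r := by simp
  have hZ := measurable_steadyInventory D hD_meas r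
  have hZint : Integrable (steadyInventory D r) P := by
    refine ⟨hZ.aestronglyMeasurable, ?_⟩
    rw [hasFiniteIntegral_iff_ofReal (ae_of_all _ (steadyInventory_nonneg D r)),
      lintegral_steadyInventory hD_meas hL]
    exact hL.lt_top
  have hν : ∫ z, z ∂(P.map (steadyInventory D r)) =
      (∫⁻ ω, ⨆ t, ENNReal.ofReal (backInventory r t (fun i => D i ω)) ∂P).toReal := by
    rw [integral_map hZ.aemeasurable (by fun_prop), ← lintegral_steadyInventory hD_meas hL]
    exact integral_eq_lintegral_of_nonneg_ae (ae_of_all _ (steadyInventory_nonneg D r)) hZint.1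
  have hsol := hD.isWienerHopfSolution hD_nonneg h p hint hgain hL hν hv
  have hgrowth := hD.hasModerateGrowth hh hp hε hφ hφ' hv
  refine ⟨ae_ladderEvent he, ?_, fun y => ?_, ⟨P.map (steadyInventory D r),
    hD.isSteadyState hL, ?_, hsol, hgrowth, fun v hvs hvg x hx =>
      IsWienerHopfSolution.unique hexp hvs hsol hvg hgrowth hx⟩, fun x₁ x₂ h₁ h₂ => ?_⟩
  -- The integral of a nonintegrable function is `0` by default, whereas Wald's identity shows that
  -- this one is positive.
  · refine Integrable.of_integral_ne_zero (ne_of_gt ?_)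
    change 0 < ladderMean P D r
    rw [hD.ladderMean_eq hint he]
    refine mul_pos (ENNReal.toReal_pos ?_ he) (sub_pos.2 hr)
    exact (zero_lt_one.trans_le (one_le_meanLadderTime P D r)).ne'
  · exact ((le_mul_of_one_le_left zero_le (one_le_meanLadderTime P D r)).trans
      (hD.renewal_le he y)).trans_lt (hpass y).lt_top
  · rw [integrable_map_measure (by fun_prop) hZ.aemeasurable]
    exact hZint
  · rw [hv x₁ h₁, hv x₂ h₂]
    exact tendsto_integral_cost_sub hD_meas hintt h p hgain h₁ h₂
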